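/- Let $(E_n,\mathcal{E}_n)_{n\ge 0}$ be measurable spaces, $x_0\in E_0$ a fixed point, $B_n\in\mathcal{E}_n$ measurable sets with indicator potentials $G_n=\mathbb{1}_{B_n}$, $n\ge 1$, and $M_n$, $n\ge 1$, Markov kernels from $E_{n-1}$ to $E_n$. Let $(X_n)_{n\ge 0}$ be the inhomogeneous Markov chain with $X_0=x_0$ and transition kernels $M_n$. For $n\ge 1$ and $\varphi$ bounded and measurable on $E_n$ put $$\gamma_n(\varphi)=\mathbb{E}_{x_0}\Big[\prod_{p=1}^{n-1}G_p(X_p)\,\varphi(X_n)\Big],\qquad \eta_n(\varphi)=\frac{\gamma_n(\varphi)}{\gamma_n(1)} .$$ Alive particle filter with parameter $N\ge 2$: at time $1$ sample $x_1^1,x_1^2,\dots$ i.i.d. from $M_1(x_0,\cdot)$; at time $n\ge 2$, given the past, sample $x_n^1,x_n^2,\dots$ i.i.d. from the law $\Phi_n(\eta_{n-1}^{T_{n-1}})$ given by $$\Phi_n(\mu)(\varphi)=\frac{\mu(G_{n-1}M_n(\varphi))}{\mu(G_{n-1})} .$$ Here, for each $n\ge 1$, sampling is stopped at $$T_n=\inf\Big\{k\ge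 N:\ \sum_{i=1}^k G_n(x_n^i)\ge N\Big\},\qquad \eta_n^{T_n}(\varphi)=\frac{1}{T_n-1}\sum_{i=1}^{T_n-1}\varphi(x_n^i).$$ Assume $(M_1)$: there is $\delta\in(0,1)$ such that $M_n(x,\cdot)\ge\delta M_n(y,\cdot)$ for all $n\ge1$ and $x,y\in E_{n-1}$, and there is $c\in(0,1)$ such that $\min\{M_n(x,B_n),M_n(x,B_n^c)\}\ge c$ for all $n\ge 1$ and $x\in E_{n-1}$. Then for every real $p\in[1,4]$ there is a constant $C_p<\infty$ such that for all $n\ge 1$, all $N\ge 2$ and all bounded measurable $\varphi:E_n\to\mathbb{R}$, $$\mathbb{E}\big[|\eta_n^{T_n}(\varphi)-\eta_n(\varphi)|^p\big]^{1/p}\le \frac{C_p\,\|\varphi\|_\infty}{\sqrt{N-1}},\qquad \|\varphi\|_\infty=\sup_{x\in E_n}|\varphi(x)| .$$ -/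

import Mathlib

open MeasureTheory ProbabilityTheory

/-- A Feynman-Kac model with indicator potentials: a starting point `x₀`, measurable alive sets
`B n ⊆ E n` (only `n ≥ 1` matters), the potentials being their indicators, and Markov kernels
`M n` from `E n` to `E (n + 1)`; thus `M n` is the `(n + 1)`-st transition of the model. -/
structure FKModel (E : ℕ → Type*) [∀ n, MeasurableSpace (E n)] where
  /-- the fixed starting point -/
  x₀ : E 0
  /-- the alive sets -/
  B : ∀ n, Set (E n)
  measurableSet_B : ∀ n, MeasurableSet (B n)
  /-- the transition from time `n` to time `n + 1` -/
  M : ∀ n, Kernel (E n) (E (n + 1))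
  isMarkovKernel_M : ∀ n, IsMarkovKernel (M n)

namespace FKModel

variable {E : ℕ → Type*} [∀ n, MeasurableSpace (E n)]

instance (F : FKModel E) (n : ℕ) : IsMarkovKernel (F.M n) := F.isMarkovKernel_M n

/-! ### The Feynman-Kac marginals -/

/-- The indicator potential of the alive set at time `n`. -/
noncomputable def G (F : FKModel E) (n : ℕ) : E n → ℝ := (F.B n).indicator 1

/-- The transition kernels of the Markov chain, as functions of the whole past. -/
noncomputable def chainKernel (F : FKModel E) (n : ℕ) :
    Kernel (Π i : Finset.Iic n, E i) (E (n + 1)) :=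
  (F.M n).comap (fun h => h ⟨n, Finset.mem_Iic.2 le_rfl⟩) (measurable_pi_apply _)

instance (F : FKModel E) (n : ℕ) : IsMarkovKernel (F.chainKernel n) := by
  unfold chainKernel; infer_instance

/-- The law of the inhomogeneous Markov chain started from `x₀`. -/
noncomputable def chainLaw (F : FKModel E) : Measure (Π n, E n) :=
  Kernel.trajMeasure (Measure.dirac F.x₀) F.chainKernel

/-- The unnormalized marginal `γ_n(φ) = 𝔼[∏_{1 ≤ p < n} G_p(X_p) φ(X_n)]`. -/
noncomputable def gamma (F : FKModel E) (n : ℕ) (φ : E n → ℝ) : ℝ :=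
  ∫ X, (∏ p ∈ Finset.Ico 1 n, F.G p (X p)) * φ (X n) ∂F.chainLaw

/-- The predictor `η_n(φ) = γ_n(φ) / γ_n(1)`. -/
noncomputable def eta (F : FKModel E) (n : ℕ) (φ : E n → ℝ) : ℝ :=
  F.gamma n φ / F.gamma n 1

/-- The uniform mixing condition, together with the lower bound on the probabilities of
the alive sets and of their complements. -/
def Mixing (F : FKModel E) : Prop :=
  (∃ δ : ℝ, 0 < δ ∧ δ < 1 ∧ ∀ n, ∀ x y : E n, ∀ A : Set (E (n + 1)), MeasurableSet A →
    δ * (F.M n y).real A ≤ (F.M n x).real A) ∧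
  (∃ c : ℝ, 0 < c ∧ c < 1 ∧ ∀ n, ∀ x : E n,
    c ≤ min ((F.M n x).real (F.B (n + 1))) ((F.M n x).real (F.B (n + 1))ᶜ))

/-! ### The alive particle filter

A generation is an infinite sequence of particles, conditionally i.i.d. given the past;
only the particles up to the time `T` at which the `N`-th alive one appears are ever used.
Particles are numbered from `0`: the term `x i` of a sequence is the particle number `i + 1`. -/

open Classical in
/-- The number of alive particles among the first `k` ones. -/
noncomputable def aliveCount {S : Type*} (B : Set S) (x : ℕ → S) (k : ℕ) : ℕ :=
  ∑ i ∈ Finset.range k, if x i ∈ B then 1 else 0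

/-- `T = inf {k ≥ N : ∑_{i ≤ k} G(x^i) ≥ N}`; it is set to `0` if there is no such `k`, which has
probability zero when the alive set is charged. -/
noncomputable def stopIndex {S : Type*} (N : ℕ) (B : Set S) (x : ℕ → S) : ℕ :=
  sInf {k | N ≤ k ∧ N ≤ aliveCount B x k}

/-- The estimate `(T - 1)⁻¹ ∑_{i ≤ T - 1} φ(x^i)` from one generation of particles. -/
noncomputable def particleMean {S : Type*} (N : ℕ) (B : Set S) (x : ℕ → S) (φ : S → ℝ) : ℝ :=
  (∑ i ∈ Finset.range (stopIndex N B x - 1), φ (x i)) / ((stopIndex N B x : ℝ) - 1)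

/-- The empirical measure `(T - 1)⁻¹ ∑_{i ≤ T - 1} δ_{x^i}` of one generation of particles. -/
noncomputable def empirical {S : Type*} [MeasurableSpace S] (N : ℕ) (B : Set S) (x : ℕ → S) :
    Measure S :=
  ((stopIndex N B x - 1 : ℕ) : ENNReal)⁻¹ •
    ∑ i ∈ Finset.range (stopIndex N B x - 1), Measure.dirac (x i)

open Classical in
/-- The law of each particle of the next generation, given the current one: select by the
potential and mutate, that is `Φ(η)(φ) = η(G · M φ) / η(G)` for the empirical measure `η`. In the
degenerate case where `η(G) = 0` (of probability zero in the filter when the alive sets are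
charged and `N ≥ 2`) the first particle is mutated, so as to have a probability measure. -/
noncomputable def nextLaw {S S' : Type*} [MeasurableSpace S] [MeasurableSpace S'] (N : ℕ)
    (B : Set S) (M : Kernel S S') (x : ℕ → S) : Measure S' :=
  if empirical N B x B = 0 then M (x 0) else ((empirical N B x)[|B]).bind M

section Measurability

variable {S S' : Type*} [MeasurableSpace S] [MeasurableSpace S']

lemma measurable_aliveCount {B : Set S} (hB : MeasurableSet B) (k : ℕ) :
    Measurable fun x : ℕ → S => aliveCount B x k := by
  classical
  unfold aliveCount
  refine Finset.measurable_sum _ fun i _ => ?_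
  exact Measurable.ite (measurable_pi_apply i hB) measurable_const measurable_const

lemma measurable_stopIndex (N : ℕ) {B : Set S} (hB : MeasurableSet B) :
    Measurable fun x : ℕ → S => stopIndex N B x := by
  have hP : ∀ k, MeasurableSet {x : ℕ → S | N ≤ k ∧ N ≤ aliveCount B x k} := fun k =>
    (MeasurableSet.const _).inter
      (measurableSet_le measurable_const (measurable_aliveCount hB k))
  refine measurable_of_Iic fun t => ?_
  have : (fun x : ℕ → S => stopIndex N B x) ⁻¹' Set.Iic t =
      (⋃ k ∈ Set.Iic t, {x : ℕ → S | N ≤ k ∧ N ≤ aliveCount B x k}) ∪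
        (⋂ k, {x : ℕ → S | N ≤ k ∧ N ≤ aliveCount B x k}ᶜ) := by
    ext x
    simp only [Set.mem_preimage, Set.mem_Iic, Set.mem_union, Set.mem_iUnion, Set.mem_iInter,
      Set.mem_compl_iff, exists_prop]
    constructor
    · intro h
      by_cases hne : {k | N ≤ k ∧ N ≤ aliveCount B x k}.Nonempty
      · exact Or.inl ⟨_, h, Nat.sInf_mem hne⟩
      · exact Or.inr fun k hk => hne ⟨k, hk⟩
    · rintro (⟨k, hk, hx⟩ | h)
      · exact (Nat.sInf_le hx).trans hk
      · have : {k | N ≤ k ∧ N ≤ aliveCount B x k} = ∅ :=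
          Set.eq_empty_iff_forall_notMem.2 h
        simp [stopIndex, this]
  rw [this]
  exact (MeasurableSet.biUnion (Set.to_countable _) fun k _ => hP k).union
    (MeasurableSet.iInter fun k => (hP k).compl)

lemma measurable_empirical (N : ℕ) {B : Set S} (hB : MeasurableSet B) :
    Measurable fun x : ℕ → S => empirical N B x := by
  have h : ∀ t : ℕ, Measurable fun x : ℕ → S =>
      ((t - 1 : ℕ) : ENNReal)⁻¹ • ∑ i ∈ Finset.range (t - 1), Measure.dirac (x i) := by
    intro t
    refine Measure.measurable_of_measurable_coe _ fun A hA => ?_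
    simp only [Measure.smul_apply, Measure.coe_finsetSum, Finset.sum_apply, smul_eq_mul]
    refine Measurable.const_mul (Finset.measurable_sum _ fun i _ => ?_) _
    exact (Measure.measurable_coe hA).comp
      (Measure.measurable_dirac.comp (measurable_pi_apply i))
  intro U hU
  have hset : (fun x : ℕ → S => empirical N B x) ⁻¹' U = ⋃ t : ℕ,
      ((fun x : ℕ → S => stopIndex N B x) ⁻¹' {t}) ∩ ((fun x : ℕ → S =>
        ((t - 1 : ℕ) : ENNReal)⁻¹ • ∑ i ∈ Finset.range (t - 1), Measure.dirac (x i)) ⁻¹' U) := by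
    ext x
    rw [Set.mem_iUnion]
    constructor
    · intro hx
      exact ⟨stopIndex N B x, rfl, hx⟩
    · rintro ⟨t, ht, hx⟩
      have ht' : stopIndex N B x = t := ht
      subst ht'
      exact hx
  rw [hset]
  exact MeasurableSet.iUnion fun t =>
    (measurable_stopIndex N hB (measurableSet_singleton t)).inter (h t hU)

lemma isFiniteMeasure_empirical (N : ℕ) (B : Set S) (x : ℕ → S) :
    IsFiniteMeasure (empirical N B x) := by
  refine ⟨?_⟩
  unfold empirical
  rcases Nat.eq_zero_or_pos (stopIndex N B x - 1) with h | h
  · simp [h]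
  · have : ((stopIndex N B x - 1 : ℕ) : ENNReal)⁻¹ ≠ ⊤ := 
      ENNReal.inv_ne_top.2 (Nat.cast_ne_zero.2 h.ne')
    rw [Measure.smul_apply, smul_eq_mul]
    exact ENNReal.mul_lt_top this.lt_top (measure_lt_top _ _)

lemma measurable_nextLaw (N : ℕ) {B : Set S} (hB : MeasurableSet B) (M : Kernel S S') :
    Measurable fun x : ℕ → S => nextLaw N B M x := by
  classical
  have he := measurable_empirical (S := S) N hB
  refine Measurable.ite (((Measure.measurable_coe hB).comp he) (measurableSet_singleton 0))
    (M.measurable.comp (measurable_pi_apply 0)) ?_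
  refine (Measure.measurable_bind' M.measurable).comp ?_
  refine Measure.measurable_of_measurable_coe _ fun A hA => ?_
  simp only [cond_apply hB]
  exact ((Measure.measurable_coe hB).comp he).inv.mul
    ((Measure.measurable_coe (hB.inter hA)).comp he)

instance isProbabilityMeasure_nextLaw (N : ℕ) (B : Set S) (M : Kernel S S') [IsMarkovKernel M]
    (x : ℕ → S) : IsProbabilityMeasure (nextLaw N B M x) := by
  have := isFiniteMeasure_empirical N B x
  unfold nextLaw
  split_ifs with h
  · infer_instance
  · have := cond_isProbabilityMeasure h
    infer_instance

/-- The law of an i.i.d. sequence depends measurably on the law of its terms. -/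
lemma measurable_iid {Ω : Type*} [MeasurableSpace Ω] {ν : Ω → Measure S}
    [∀ ω, IsProbabilityMeasure (ν ω)] (hν : Measurable ν) :
    Measurable fun ω => Measure.infinitePi fun _ : ℕ => ν ω := by
  refine Measurable.measure_of_isPiSystem_of_isProbabilityMeasure
    generateFrom_squareCylinders.symm
    (isPiSystem_squareCylinders (fun _ => MeasurableSpace.isPiSystem_measurableSet) (by simp)) ?_
  rintro _ ⟨s, t, ht, rfl⟩
  have ht' : ∀ i, MeasurableSet (t i) := fun i => ht i (Set.mem_univ i)
  have h : (fun ω => Measure.infinitePi (fun _ : ℕ => ν ω) ((s : Set ℕ).pi t)) =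
      fun ω => ∏ i ∈ s, ν ω (t i) := by
    funext ω
    exact Measure.infinitePi_pi (fun _ : ℕ => ν ω) fun i _ => ht' i
  rw [h]
  exact Finset.measurable_prod _ fun i _ => (Measure.measurable_coe (ht' i)).comp hν

end Measurability

/-- The law of each particle of generation `n + 1`, given generation `n`. At time `0` all
particles sit at `x₀` and nothing is selected. -/
noncomputable def particleLaw (F : FKModel E) (N : ℕ) : ∀ n, (ℕ → E n) → Measure (E (n + 1))
  | 0, x => F.M 0 (x 0)
  | n + 1, x => nextLaw N (F.B (n + 1)) (F.M (n + 1)) x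

instance (F : FKModel E) (N n : ℕ) (x : ℕ → E n) :
    IsProbabilityMeasure (F.particleLaw N n x) := by
  cases n <;> (unfold particleLaw; infer_instance)

lemma measurable_particleLaw (F : FKModel E) (N n : ℕ) : Measurable (F.particleLaw N n) := by
  cases n with
  | zero => exact (F.M 0).measurable.comp (measurable_pi_apply 0)
  | succ n => exact measurable_nextLaw N (F.measurableSet_B (n + 1)) (F.M (n + 1))

/-- Given generation `n`, the particles of generation `n + 1` are i.i.d. -/
noncomputable def generationKernel (F : FKModel E) (N n : ℕ) :
    Kernel (ℕ → E n) (ℕ → E (n + 1)) where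
  toFun x := Measure.infinitePi fun _ : ℕ => F.particleLaw N n x
  measurable' := measurable_iid (F.measurable_particleLaw N n)

instance (F : FKModel E) (N n : ℕ) : IsMarkovKernel (F.generationKernel N n) :=
  ⟨fun x => inferInstanceAs
    (IsProbabilityMeasure (Measure.infinitePi fun _ : ℕ => F.particleLaw N n x))⟩

/-- The transitions between generations, as functions of the whole past. -/
noncomputable def filterKernel (F : FKModel E) (N n : ℕ) :
    Kernel (Π i : Finset.Iic n, (ℕ → E i)) (ℕ → E (n + 1)) :=
  (F.generationKernel N n).comap (fun h => h ⟨n, Finset.mem_Iic.2 le_rfl⟩) (measurable_pi_apply _)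

instance (F : FKModel E) (N n : ℕ) : IsMarkovKernel (F.filterKernel N n) := by
  unfold filterKernel; infer_instance

/-- The law of the alive particle filter with parameter `N`: `ω n i` is the particle number
`i + 1` of generation `n`. -/
noncomputable def filterLaw (F : FKModel E) (N : ℕ) : Measure (Π n, (ℕ → E n)) :=
  Kernel.trajMeasure (X := fun n => ℕ → E n) (Measure.dirac fun _ => F.x₀) (F.filterKernel N)

/-- The alive particle filter estimate `η_n^{T_n}(φ)` of the predictor. -/
noncomputable def etaHat (F : FKModel E) (N n : ℕ) (φ : E n → ℝ) (ω : Π n, (ℕ → E n)) : ℝ :=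
  particleMean N (F.B n) (ω n) φ

end FKModel

/-! Everything is proved for the fourth moment, with rate `1 / (N - 1) ^ 2`; the exponents `p ≤ 4`
follow because L^p norms increase in `p` on a probability space. Two ingredients carry the proof.

Local error. Given the past, a generation is i.i.d. with some law `ν` charging the alive set with
mass at least `c`. Follow the sum `s` of the centred values and the number `r` of alive particles
still missing. Since `r` drops with probability at least `c` at each step, `s ^ 4 + α s ^ 2 r + β r
^ 2` is a supermartingale for suitable `α`, `β` (`lintegral_walkEnergy_step_le`). It starts at `β N
^ 2`, so the sum stopped at `T` has fourth moment of order `N ^ 2`. Dropping the last particle costs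
a bounded term, and dividing by `T - 1 ≥ N - 1` gives `lintegral_particleMean_sub_pow_four_le`. The
bound passes to the ratios created by selection in `lintegral_selectedMean_sub_pow_four_le`.

Stability. A ratio `μ(G h φ) / μ(G h)` at time `n + 1` becomes, one step back, a ratio of the same
shape with a new weight and a new test function (`pullWeight`, `pullFun`). This holds both for the
exact flow (`twistedMean_succ`) and for the sampling law of the filter (`Stops.selection_eq`).
Mixing keeps the ratios of values of the weight above `δ` and shrinks the oscillation of the test
function by `1 - δ ^ 2` (`pullFun_sub_le`). Hence old local errors are damped geometrically, and the
induction in `lintegral_selectedMean_sub_twistedMean_le` closes with a constant free of `n`. -/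

/-! ### One-step disintegration of trajectory measures. -/

section Trajectory

open Preorder

variable {X : ℕ → Type*} [∀ n, MeasurableSpace (X n)] {μ₀ : Measure (X 0)}
  {κ : (n : ℕ) → Kernel (Π i : Finset.Iic n, X i) (X (n + 1))}
  [∀ n, IsMarkovKernel (κ n)]

lemma lintegral_trajMeasure_succ [IsProbabilityMeasure μ₀] {n : ℕ}
    {f : (Π i : Finset.Iic n, X i) × X (n + 1) → ENNReal}
    (hf : Measurable f) :
    ∫⁻ ω, f (frestrictLe n ω, ω (n + 1)) ∂(Kernel.trajMeasure μ₀ κ) =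
      ∫⁻ ω, ∫⁻ y, f (frestrictLe n ω, y) ∂κ n (frestrictLe n ω) ∂(Kernel.trajMeasure μ₀ κ) := by
  have h := Kernel.map_frestrictLe_trajMeasure_compProd_eq_map_trajMeasure (μ₀ := μ₀) (κ := κ)
    (a := n)
  rw [← lintegral_map (g := fun ω : Π n, X n => (frestrictLe n ω, ω (n + 1))) hf (by fun_prop),
    ← h, Measure.lintegral_compProd hf, lintegral_map _ (by fun_prop)]
  exact hf.lintegral_kernel_prod_right'

lemma integral_trajMeasure_succ [IsProbabilityMeasure μ₀] {n : ℕ}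
    {f : (Π i : Finset.Iic n, X i) × X (n + 1) → ℝ}
    (hf : Measurable f) {K : ℝ} (hK : ∀ z, |f z| ≤ K) :
    ∫ ω, f (frestrictLe n ω, ω (n + 1)) ∂(Kernel.trajMeasure μ₀ κ) =
      ∫ ω, ∫ y, f (frestrictLe n ω, y) ∂κ n (frestrictLe n ω) ∂(Kernel.trajMeasure μ₀ κ) := by
  have h := Kernel.map_frestrictLe_trajMeasure_compProd_eq_map_trajMeasure (μ₀ := μ₀) (κ := κ)
    (a := n)
  have : IsProbabilityMeasure ((Kernel.trajMeasure μ₀ κ).map (frestrictLe n)) :=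
    Measure.isProbabilityMeasure_map (by fun_prop)
  rw [← integral_map (φ := fun ω : Π n, X n => (frestrictLe n ω, ω (n + 1))) (by fun_prop)
    hf.aestronglyMeasurable, ← h, Measure.integral_compProd, integral_map (by fun_prop)]
  · exact (hf.stronglyMeasurable.integral_kernel_prod_right').aestronglyMeasurable
  · exact Integrable.of_bound hf.aestronglyMeasurable K (ae_of_all _ hK)

lemma map_zero_trajMeasure :
    (Kernel.trajMeasure μ₀ κ).map (fun ω => ω 0) = μ₀ := by
  let g : (Π i : Finset.Iic 0, X i) → X 0 := fun z => z ⟨0, Finset.mem_Iic.2 le_rfl⟩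
  have hg : Measurable g := measurable_pi_apply _
  have h : (fun ω : Π n, X n => ω 0) = g ∘ frestrictLe 0 := rfl
  rw [h, ← Measure.map_map hg (by fun_prop), Kernel.trajMeasure,
    Measure.map_comp _ _ (by fun_prop), Kernel.traj_map_frestrictLe, Kernel.partialTraj_self,
    Measure.id_comp]
  exact (Measure.map_map hg (MeasurableEquiv.piUnique fun i : Finset.Iic 0 => X i).symm.measurable
    : Measure.map g (Measure.map _ μ₀) = _).trans Measure.map_id

end Trajectory

/-! ### Recursion for the unnormalized marginals. -/

namespace FKModel

variable {E : ℕ → Type*} [∀ n, MeasurableSpace (E n)]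

lemma measurable_G (F : FKModel E) (n : ℕ) : Measurable (F.G n) :=
  measurable_one.indicator (F.measurableSet_B n)

lemma G_nonneg (F : FKModel E) (n : ℕ) (x : E n) : 0 ≤ F.G n x :=
  Set.indicator_nonneg (fun _ _ => zero_le_one) x

lemma G_le_one (F : FKModel E) (n : ℕ) (x : E n) : F.G n x ≤ 1 :=
  Set.indicator_le_self' (fun _ _ => zero_le_one) x

lemma abs_G_mul_le (F : FKModel E) (n : ℕ) (x : E n) (a : ℝ) : |F.G n x * a| ≤ |a| := by
  rw [abs_mul, abs_of_nonneg (F.G_nonneg n x)]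
  exact mul_le_of_le_one_left (abs_nonneg a) (F.G_le_one n x)

/-- Integration against the transition kernel. -/
noncomputable def mutate (F : FKModel E) (n : ℕ) (φ : E (n + 1) → ℝ) (x : E n) : ℝ :=
  ∫ y, φ y ∂F.M n x

lemma measurable_mutate (F : FKModel E) (n : ℕ) {φ : E (n + 1) → ℝ} (hφ : Measurable φ) :
    Measurable (F.mutate n φ) :=
  (StronglyMeasurable.integral_kernel (κ := F.M n) hφ.stronglyMeasurable).measurable

lemma abs_mutate_le (F : FKModel E) (n : ℕ) {φ : E (n + 1) → ℝ} {K : ℝ} (hK : ∀ y, |φ y| ≤ K)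
    (x : E n) : |F.mutate n φ x| ≤ K := by
  simpa [mutate] using norm_integral_le_of_norm_le_const (μ := F.M n x) (f := φ) (ae_of_all _ hK)

lemma gamma_one (F : FKModel E) {φ : E 1 → ℝ} (hφ : Measurable φ) {K : ℝ}
    (hK : ∀ y, |φ y| ≤ K) : F.gamma 1 φ = F.mutate 0 φ F.x₀ := by
  have h := integral_trajMeasure_succ (μ₀ := Measure.dirac F.x₀) (κ := F.chainKernel) (n := 0)
    (f := fun z => φ z.2) (by fun_prop) (K := K) fun z => hK z.2
  have h' : (Measure.dirac F.x₀).map id = Measure.dirac F.x₀ := Measure.map_id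
  rw [gamma]
  simp only [Finset.Ico_self, Finset.prod_empty, one_mul]
  refine h.trans ?_
  change ∫ ω, F.mutate 0 φ (ω 0) ∂F.chainLaw = _
  rw [← integral_map (φ := fun ω : Π n, E n => ω 0)
    (measurable_pi_apply 0).aemeasurable (F.measurable_mutate 0 hφ).aestronglyMeasurable, chainLaw,
    map_zero_trajMeasure,
    integral_dirac' _ _ (F.measurable_mutate 0 hφ).stronglyMeasurable]

/-- Condition on the chain up to time `n`, then split the factor `G n` off the product and attach it
to the test function. -/
lemma gamma_succ (F : FKModel E) {n : ℕ} (hn : 1 ≤ n) {φ : E (n + 1) → ℝ} (hφ : Measurable φ)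
    {K : ℝ} (hK : ∀ y, |φ y| ≤ K) :
    F.gamma (n + 1) φ = F.gamma n fun x => F.G n x * F.mutate n φ x := by
  have hG := F.measurable_G
  -- The history includes time `0`, which carries no potential; its factor is replaced by `1`.
  let f : (Π i : Finset.Iic n, E i) × E (n + 1) → ℝ := fun z =>
    (∏ p : Finset.Iic n, if 1 ≤ (p : ℕ) then F.G p (z.1 p) else 1) * φ z.2
  have hf : Measurable f := by
    refine Measurable.mul (Finset.measurable_prod _ fun p _ => ?_) (hφ.comp measurable_snd)
    split_ifs
    · exact (hG p).comp ((measurable_pi_apply p).comp measurable_fst)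
    · exact measurable_const
  have hprod : ∀ ω : Π n, E n, (∏ p : Finset.Iic n, if 1 ≤ (p : ℕ) then
      F.G p (Preorder.frestrictLe n ω p) else 1) = ∏ p ∈ Finset.Ico 1 (n + 1), F.G p (ω p) := by
    intro ω
    have := Finset.prod_coe_sort (Finset.Iic n) fun p => if 1 ≤ p then F.G p (ω p) else 1
    refine this.trans ?_
    rw [← Finset.prod_filter]
    refine Finset.prod_congr ?_ fun _ _ => rfl
    ext p
    simp only [Finset.mem_filter, Finset.mem_Iic, Finset.mem_Ico]
    omega
  have h := integral_trajMeasure_succ (μ₀ := Measure.dirac F.x₀) (κ := F.chainKernel) (n := n)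
    hf (K := K) fun z => by
      simp only [f]
      rw [abs_mul]
      refine (mul_le_of_le_one_left (abs_nonneg _) ?_).trans (hK _)
      rw [Finset.abs_prod]
      refine Finset.prod_le_one (fun _ _ => abs_nonneg _) fun p _ => ?_
      split_ifs
      · rw [abs_of_nonneg (F.G_nonneg _ _)]
        exact F.G_le_one _ _
      · simp
  simp only [f, hprod] at h
  rw [gamma]
  refine h.trans ?_
  rw [gamma]
  refine integral_congr_ae (ae_of_all _ fun ω => ?_)
  simp only []
  rw [integral_const_mul, Finset.prod_Ico_succ_top hn, mul_assoc]
  rfl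

/-! ### Fourth moment of the sampling error of one generation. -/

section LocalError

open Filter Topology

variable {S : Type*}

lemma aliveCount_succ (B : Set S) [DecidablePred (· ∈ B)] (x : ℕ → S) (k : ℕ) :
    aliveCount B x (k + 1) = aliveCount B x k + if x k ∈ B then 1 else 0 := by
  rw [aliveCount, aliveCount, Finset.sum_range_succ]
  congr

lemma aliveCount_le (B : Set S) (x : ℕ → S) (k : ℕ) : aliveCount B x k ≤ k := by
  classical
  induction k with
  | zero => simp [aliveCount]
  | succ k ih =>
    rw [aliveCount_succ]
    split_ifs <;> omega

/-- The alive set is hit often enough for the sampling to stop. -/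
def Stops (N : ℕ) (B : Set S) (x : ℕ → S) : Prop := ∃ k, N ≤ aliveCount B x k

lemma Stops.stopIndex_mem {N : ℕ} {B : Set S} {x : ℕ → S} (h : Stops N B x) :
    N ≤ stopIndex N B x ∧ N ≤ aliveCount B x (stopIndex N B x) := by
  obtain ⟨k, hk⟩ := h
  exact Nat.sInf_mem (s := {k | N ≤ k ∧ N ≤ aliveCount B x k})
    ⟨k, hk.trans (aliveCount_le B x k), hk⟩

lemma aliveCount_lt_of_lt_stopIndex {N : ℕ} {B : Set S} {x : ℕ → S} {j : ℕ}
    (hj : j < stopIndex N B x) : aliveCount B x j < N := by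
  by_contra! h
  exact Nat.notMem_of_lt_sInf hj ⟨h.trans (aliveCount_le B x j), h⟩

/-- By minimality of `T` the count is below `N` just before, and one particle adds at most one. For
`N ≥ 2` this leaves an alive particle among the first `T - 1`, so selection is not degenerate. -/
lemma Stops.aliveCount_pred {N : ℕ} (hN : 1 ≤ N) {B : Set S} {x : ℕ → S} (h : Stops N B x) :
    aliveCount B x (stopIndex N B x - 1) = N - 1 := by
  classical
  obtain ⟨h1, h2⟩ := h.stopIndex_mem
  have h3 : aliveCount B x (stopIndex N B x - 1) < N :=
    aliveCount_lt_of_lt_stopIndex (by omega)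
  have h4 := aliveCount_succ B x (stopIndex N B x - 1)
  rw [Nat.sub_add_cancel (by omega)] at h4
  split_ifs at h4 <;> omega

open Classical in
/-- One step of the walk recording the partial sum of the increments and the number of alive
particles still to be found; it is frozen when there is none left. -/
noncomputable def walkStep (B : Set S) (ξ : S → ℝ) (u : ℝ × ℕ) (y : S) : ℝ × ℕ :=
  if u.2 = 0 then u else (u.1 + ξ y, u.2 - if y ∈ B then 1 else 0)

/-- The walk driven by a sequence of particles. -/
noncomputable def stoppedWalk (B : Set S) (ξ : S → ℝ) (N : ℕ) (x : ℕ → S) : ℕ → ℝ × ℕ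
  | 0 => (0, N)
  | k + 1 => walkStep B ξ (stoppedWalk B ξ N x k) (x k)

lemma stoppedWalk_congr (B : Set S) (ξ : S → ℝ) (N : ℕ) {x y : ℕ → S} {k : ℕ}
    (h : ∀ i < k, x i = y i) : stoppedWalk B ξ N x k = stoppedWalk B ξ N y k := by
  induction k with
  | zero => rfl
  | succ k ih =>
    rw [stoppedWalk, stoppedWalk, ih fun i hi => h i (by omega), h k (by omega)]

lemma stoppedWalk_eq (B : Set S) (ξ : S → ℝ) (N : ℕ) (x : ℕ → S) {k : ℕ}
    (h : ∀ j < k, aliveCount B x j < N) :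
    stoppedWalk B ξ N x k = (∑ i ∈ Finset.range k, ξ (x i), N - aliveCount B x k) := by
  classical
  induction k with
  | zero => simp [stoppedWalk, aliveCount]
  | succ k ih =>
    have hk := h k (by omega)
    rw [stoppedWalk, ih fun j hj => h j (by omega), walkStep, if_neg (by simp; omega),
      Finset.sum_range_succ, aliveCount_succ, Nat.sub_sub]

lemma Stops.stoppedWalk_eq {N : ℕ} {B : Set S} {x : ℕ → S} (h : Stops N B x) (ξ : S → ℝ) {k : ℕ}
    (hk : stopIndex N B x ≤ k) :
    stoppedWalk B ξ N x k = (∑ i ∈ Finset.range (stopIndex N B x), ξ (x i), 0) := by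
  induction k, hk using Nat.le_induction with
  | base =>
    rw [FKModel.stoppedWalk_eq B ξ N x fun j hj => aliveCount_lt_of_lt_stopIndex hj,
      Nat.sub_eq_zero_of_le h.stopIndex_mem.2]
  | succ k _ ih => rw [stoppedWalk, ih, walkStep, if_pos rfl]

lemma Stops.particleMean_sub {N : ℕ} (hN : 2 ≤ N) {B : Set S} {x : ℕ → S} (h : Stops N B x)
    (f : S → ℝ) (a : ℝ) :
    particleMean N B x f - a = particleMean N B x fun y => f y - a := by
  obtain ⟨h1, -⟩ := h.stopIndex_mem
  have h2 : ((stopIndex N B x - 1 : ℕ) : ℝ) = stopIndex N B x - 1 := by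
    rw [Nat.cast_sub (by omega)]; simp
  have h3 : (stopIndex N B x : ℝ) - 1 ≠ 0 := by
    have : (2 : ℝ) ≤ stopIndex N B x := by exact_mod_cast hN.trans h1
    linarith
  rw [particleMean, particleMean, Finset.sum_sub_distrib, Finset.sum_const, Finset.card_range,
    nsmul_eq_mul, h2]
  field_simp

variable [MeasurableSpace S]

lemma measurable_walkStep {B : Set S} (hB : MeasurableSet B) {ξ : S → ℝ} (hξ : Measurable ξ) :
    Measurable fun z : (ℝ × ℕ) × S => walkStep B ξ z.1 z.2 := by
  classical
  unfold walkStep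
  refine Measurable.ite ((measurable_snd.comp measurable_fst) (measurableSet_singleton 0))
    measurable_fst ?_
  refine Measurable.prodMk (by fun_prop) (Measurable.sub (by fun_prop) ?_)
  exact Measurable.ite (measurable_snd hB) measurable_const measurable_const

lemma measurable_stoppedWalk {B : Set S} (hB : MeasurableSet B) {ξ : S → ℝ} (hξ : Measurable ξ)
    (N k : ℕ) : Measurable fun x : ℕ → S => stoppedWalk B ξ N x k := by
  induction k with
  | zero => exact measurable_const
  | succ k ih =>
    exact (measurable_walkStep hB hξ).comp (ih.prodMk (measurable_pi_apply k))

variable (ν : Measure S) [IsProbabilityMeasure ν]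

/-- The walk at time `k` reads only the particles of index below `k`. To express this, `ext` pads a
finite block with an arbitrary point. -/
lemma indepFun_stoppedWalk {B : Set S} (hB : MeasurableSet B) {ξ : S → ℝ} (hξ : Measurable ξ)
    (N k : ℕ) :
    IndepFun (fun x : ℕ → S => stoppedWalk B ξ N x k) (fun x : ℕ → S => x k)
      (Measure.infinitePi fun _ : ℕ => ν) := by
  classical
  obtain ⟨s₀⟩ : Nonempty S := nonempty_of_isProbabilityMeasure ν
  have hi : iIndepFun (fun i (x : ℕ → S) => x i) (Measure.infinitePi fun _ : ℕ => ν) :=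
    iIndepFun_infinitePi (P := fun _ : ℕ => ν) (X := fun _ => id) fun _ => measurable_id
  have h := hi.indepFun_finset (Finset.range k) {k} (by simp) fun i => measurable_pi_apply i
  let ext : (Finset.range k → S) → ℕ → S := fun z i => if hi : i ∈ Finset.range k then z ⟨i, hi⟩
    else s₀
  have hext : Measurable ext := by
    refine measurable_pi_lambda _ fun i => ?_
    by_cases hi : i ∈ Finset.range k
    · simpa only [ext, hi, dite_true] using measurable_pi_apply _
    · simpa only [ext, hi, dite_false] using measurable_const
  have h' := h.comp ((measurable_stoppedWalk hB hξ N k).comp hext)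
    (measurable_pi_apply (⟨k, Finset.mem_singleton_self k⟩ : ({k} : Finset ℕ)))
  refine h'.congr (ae_of_all _ fun x => ?_) (ae_of_all _ fun x => rfl)
  refine stoppedWalk_congr B ξ N fun i hi => ?_
  simp [ext, hi]

lemma lintegral_stoppedWalk_succ {B : Set S} (hB : MeasurableSet B) {ξ : S → ℝ}
    (hξ : Measurable ξ) (N k : ℕ) {V : ℝ × ℕ → ENNReal} (hV : Measurable V) :
    ∫⁻ x, V (stoppedWalk B ξ N x (k + 1)) ∂(Measure.infinitePi fun _ : ℕ => ν) =
      ∫⁻ x, ∫⁻ y, V (walkStep B ξ (stoppedWalk B ξ N x k) y) ∂ν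
        ∂(Measure.infinitePi fun _ : ℕ => ν) := by
  have hw := measurable_stoppedWalk hB hξ N k
  have hi := indepFun_stoppedWalk ν hB hξ N k
  have hm := hV.comp (measurable_walkStep hB hξ)
  rw [indepFun_iff_map_prod_eq_prod_map_map hw.aemeasurable (measurable_pi_apply k).aemeasurable,
    Measure.infinitePi_map_eval] at hi
  have h1 := lintegral_map (μ := Measure.infinitePi fun _ : ℕ => ν) hm
    (hw.prodMk (measurable_pi_apply k))
  rw [hi, lintegral_prod _ hm.aemeasurable, lintegral_map hm.lintegral_prod_right' hw] at h1
  exact h1.symm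

/-- The Lyapunov function of the stopped walk. -/
noncomputable def walkEnergy (c d : ℝ) (u : ℝ × ℕ) : ℝ :=
  u.1 ^ 4 + 16 * d ^ 2 / c * (u.1 ^ 2 * u.2) +
    (3 * d ^ 4 + 16 * d ^ 2 / c * (2 * d ^ 2 / c + d ^ 2)) / c * (u.2 : ℝ) ^ 2

lemma walkEnergy_nonneg {c : ℝ} (hc : 0 < c) (d : ℝ) (u : ℝ × ℕ) : 0 ≤ walkEnergy c d u := by
  unfold walkEnergy; positivity

lemma measurable_walkEnergy (c d : ℝ) : Measurable (walkEnergy c d) := by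
  unfold walkEnergy
  have : Measurable fun u : ℝ × ℕ => (u.2 : ℝ) := measurable_from_nat.comp measurable_snd
  fun_prop

/-- The upper bound is affine in the increment `e` and the alive indicator `g`, so that integrating
it needs only the mean of `e`, which is zero, and that of `g`, which is at least `c`. -/
lemma walkEnergy_step_le {c d s e g r : ℝ} (hc : 0 < c) (hd : 0 ≤ d) (he : |e| ≤ d)
    (hg : g = 0 ∨ g = 1) (hr : 1 ≤ r) {α β : ℝ} (hα : 0 ≤ α) (hβ : 0 ≤ β) :
    (s + e) ^ 4 + α * ((s + e) ^ 2 * (r - g)) + β * (r - g) ^ 2 ≤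
      (s ^ 4 + α * (s ^ 2 * r) + β * r ^ 2 + 8 * d ^ 2 * s ^ 2 + 3 * d ^ 4 +
        α * (c / 2 * s ^ 2 + 2 * d ^ 2 / c + d ^ 2 * r)) +
      (4 * s ^ 3 + 2 * α * r * s) * e - (α * s ^ 2 + β * r) * g := by
  have he2 : e ^ 2 ≤ d ^ 2 := sq_le_sq' (by linarith [neg_abs_le e]) ((le_abs_self e).trans he)
  have h1 : (s + e) ^ 4 ≤ s ^ 4 + 4 * s ^ 3 * e + 8 * d ^ 2 * s ^ 2 + 3 * d ^ 4 := by
    have h4 : e ^ 4 ≤ d ^ 4 := by nlinarith [sq_nonneg e, sq_nonneg d]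
    have h3 : 4 * s * e ^ 3 ≤ 2 * (s ^ 2 * e ^ 2) + 2 * e ^ 4 := by
      nlinarith [sq_nonneg (e * (s - e))]
    have h2 : s ^ 2 * e ^ 2 ≤ s ^ 2 * d ^ 2 := mul_le_mul_of_nonneg_left he2 (sq_nonneg s)
    nlinarith
  have h2 : (s + e) ^ 2 * (r - g) ≤ s ^ 2 * r - s ^ 2 * g + 2 * r * s * e +
      (c / 2 * s ^ 2 + 2 * d ^ 2 / c + d ^ 2 * r) := by
    -- Young's inequality; the share `c / 2` uses up only half of the drift `c * s ^ 2` gained from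
    -- `g`.
    have hx : -(2 * s * e * g) ≤ c / 2 * s ^ 2 + 2 * d ^ 2 / c := by
      have h5 : -(2 * s * e * g) ≤ 2 * |s| * d := by
        have : |s * e| ≤ |s| * d := by rw [abs_mul]; gcongr
        have := neg_abs_le (s * e)
        have : 0 ≤ |s| * d := by positivity
        rcases hg with rfl | rfl <;> nlinarith
      have h6 : c / 2 * s ^ 2 + 2 * d ^ 2 / c - 2 * |s| * d =
          (c * |s| - 2 * d) ^ 2 / (2 * c) := by
        rw [← sq_abs s]; field_simp; ring
      have : 0 ≤ (c * |s| - 2 * d) ^ 2 / (2 * c) := by positivity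
      linarith
    have : e ^ 2 * (r - g) ≤ d ^ 2 * r := by
      have : 0 ≤ g := by rcases hg with rfl | rfl <;> norm_num
      nlinarith [sq_nonneg e, mul_nonneg (sq_nonneg e) this]
    nlinarith
  have h3 : (r - g) ^ 2 ≤ r ^ 2 - r * g := by
    rcases hg with rfl | rfl <;> nlinarith
  have := mul_le_mul_of_nonneg_left h2 hα
  have := mul_le_mul_of_nonneg_left h3 hβ
  linarith

lemma lintegral_walkEnergy_step_le {B : Set S} (hB : MeasurableSet B) {c d : ℝ} (hc : 0 < c)
    (hνB : c ≤ ν.real B) (hd : 0 ≤ d) {ξ : S → ℝ} (hξ : Measurable ξ) (hξd : ∀ y, |ξ y| ≤ d)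
    (hξ0 : ∫ y, ξ y ∂ν = 0) (u : ℝ × ℕ) :
    ∫⁻ y, ENNReal.ofReal (walkEnergy c d (walkStep B ξ u y)) ∂ν ≤
      ENNReal.ofReal (walkEnergy c d u) := by
  classical
  obtain ⟨s, r⟩ := u
  rcases Nat.eq_zero_or_pos r with rfl | hr
  · simp [walkStep]
  -- `α * c = 16 * d ^ 2` pays for `8 * d ^ 2 * s ^ 2` from the quartic term and for `α * (c / 2) *
  -- s ^ 2`, which is as large. `β * c` pays for the terms without `s`, which are at most linear in
  -- `r` because `r ≥ 1`.
  set α := 16 * d ^ 2 / c with hα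
  set β := (3 * d ^ 4 + 16 * d ^ 2 / c * (2 * d ^ 2 / c + d ^ 2)) / c with hβ
  have hα0 : 0 ≤ α := by positivity
  have hβ0 : 0 ≤ β := by positivity
  have hr' : (1 : ℝ) ≤ r := by exact_mod_cast hr
  let g : S → ℝ := B.indicator 1
  have hgm : Measurable g := measurable_one.indicator hB
  have hg01 : ∀ y, g y = 0 ∨ g y = 1 := fun y => by
    by_cases hy : y ∈ B <;> simp [g, hy]
  let a₀ := s ^ 4 + α * (s ^ 2 * r) + β * r ^ 2 + 8 * d ^ 2 * s ^ 2 + 3 * d ^ 4 +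
        α * (c / 2 * s ^ 2 + 2 * d ^ 2 / c + d ^ 2 * r)
  let b₀ := 4 * s ^ 3 + 2 * α * r * s
  let c₀ := α * s ^ 2 + β * r
  have hpt : ∀ y, walkEnergy c d (walkStep B ξ (s, r) y) ≤ a₀ + b₀ * ξ y - c₀ * g y := by
    intro y
    have hcast : ((r - (if y ∈ B then 1 else 0 : ℕ) : ℕ) : ℝ) = r - g y := by
      by_cases hy : y ∈ B
      · simp [g, hy, Nat.cast_sub hr]
      · simp [g, hy]
    rw [walkStep, if_neg (by simp; omega), walkEnergy]
    simp only []
    rw [hcast]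
    exact walkEnergy_step_le hc hd (hξd y) (hg01 y) hr' hα0 hβ0
  have hiξ : Integrable ξ ν := Integrable.of_bound hξ.aestronglyMeasurable d (ae_of_all _ hξd)
  have hig : Integrable g ν := (integrable_const 1).indicator hB
  have hi₁ : Integrable (fun y => a₀ + b₀ * ξ y) ν := (integrable_const _).add (hiξ.const_mul _)
  have hi₂ : Integrable (fun y => a₀ + b₀ * ξ y - c₀ * g y) ν := hi₁.sub (hig.const_mul _)
  have hint : ∫ y, (a₀ + b₀ * ξ y - c₀ * g y) ∂ν = a₀ - c₀ * ν.real B := by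
    have hgi : ∫ y, g y ∂ν = ν.real B := integral_indicator_one hB
    rw [integral_sub hi₁ (hig.const_mul _),
      integral_add (integrable_const _) (hiξ.const_mul _), integral_const_mul, integral_const_mul,
      hξ0, hgi]
    simp
  refine (lintegral_mono fun y => ENNReal.ofReal_le_ofReal (hpt y)).trans ?_
  rw [← ofReal_integral_eq_lintegral_ofReal hi₂
    (ae_of_all _ fun y => (walkEnergy_nonneg hc d _).trans (hpt y)), hint]
  refine ENNReal.ofReal_le_ofReal ?_
  have h1 : c₀ * c ≤ c₀ * ν.real B := by gcongr
  have h2 : α * c = 16 * d ^ 2 := by rw [hα]; field_simp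
  have h3 : β * c = 3 * d ^ 4 + α * (2 * d ^ 2 / c + d ^ 2) :=
    div_mul_cancel₀ _ hc.ne'
  have h4 : α * (2 * d ^ 2 / c) + 3 * d ^ 4 ≤ (α * (2 * d ^ 2 / c) + 3 * d ^ 4) * r :=
    le_mul_of_one_le_right (by positivity) hr'
  have h5 : c₀ * c = 16 * d ^ 2 * s ^ 2 + (3 * d ^ 4 + α * (2 * d ^ 2 / c + d ^ 2)) * r := by
    rw [← h2, ← h3]; ring
  have h6 : walkEnergy c d (s, r) = s ^ 4 + α * (s ^ 2 * r) + β * r ^ 2 := rfl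
  have h7 : α * (c / 2 * s ^ 2) = 8 * d ^ 2 * s ^ 2 := by linear_combination (s ^ 2 / 2) * h2
  rw [h6]
  simp only [a₀]
  linarith

lemma lintegral_walkEnergy_le {B : Set S} (hB : MeasurableSet B) {c d : ℝ} (hc : 0 < c)
    (hνB : c ≤ ν.real B) (hd : 0 ≤ d) {ξ : S → ℝ} (hξ : Measurable ξ) (hξd : ∀ y, |ξ y| ≤ d)
    (hξ0 : ∫ y, ξ y ∂ν = 0) (N k : ℕ) :
    ∫⁻ x, ENNReal.ofReal (walkEnergy c d (stoppedWalk B ξ N x k))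
      ∂(Measure.infinitePi fun _ : ℕ => ν) ≤ ENNReal.ofReal (walkEnergy c d (0, N)) := by
  induction k with
  | zero => simp [stoppedWalk]
  | succ k ih =>
    rw [lintegral_stoppedWalk_succ ν hB hξ N k (measurable_walkEnergy c d).ennreal_ofReal]
    exact (lintegral_mono fun x =>
      lintegral_walkEnergy_step_le ν hB hc hνB hd hξ hξd hξ0 _).trans ih

/-- By the strong law the alive frequency tends to `ν.real B > 0`, whereas a count that stays below
`N` would force the limit `0`. -/
lemma ae_stops {B : Set S} (hB : MeasurableSet B) (hνB : 0 < ν.real B) (N : ℕ) :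
    ∀ᵐ x ∂(Measure.infinitePi fun _ : ℕ => ν), Stops N B x := by
  classical
  let g : S → ℝ := B.indicator 1
  have hgm : Measurable g := measurable_one.indicator hB
  have hi : iIndepFun (fun i (x : ℕ → S) => g (x i)) (Measure.infinitePi fun _ : ℕ => ν) :=
    iIndepFun_infinitePi (P := fun _ : ℕ => ν) (X := fun _ => g) fun _ => hgm
  have hmap : ∀ i, (Measure.infinitePi fun _ : ℕ => ν).map (fun x => g (x i)) = ν.map g := by
    intro i
    have hcomp : (fun x : ℕ → S => g (x i)) = g ∘ fun x => x i := rfl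
    rw [hcomp, ← Measure.map_map (g := g) (f := fun x : ℕ → S => x i) hgm (measurable_pi_apply i),
      Measure.infinitePi_map_eval]
  have h := strong_law_ae_real (μ := Measure.infinitePi fun _ : ℕ => ν)
    (fun i (x : ℕ → S) => g (x i)) ?_ (fun i j hij => hi.indepFun hij) fun i =>
      ⟨(hgm.comp (measurable_pi_apply i)).aemeasurable,
        (hgm.comp (measurable_pi_apply 0)).aemeasurable, by rw [hmap, hmap]⟩
  · have hE : ∫ x, g (x 0) ∂(Measure.infinitePi fun _ : ℕ => ν) = ν.real B := by
      rw [← integral_map (φ := fun x : ℕ → S => x 0) (measurable_pi_apply 0).aemeasurable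
        hgm.aestronglyMeasurable, Measure.infinitePi_map_eval]
      exact integral_indicator_one hB
    filter_upwards [h] with x hx
    rw [hE] at hx
    by_contra hne
    have hlt : ∀ k, aliveCount B x k < N := fun k => not_le.1 fun hk => hne ⟨k, hk⟩
    have hcount : ∀ k, ∑ i ∈ Finset.range k, g (x i) = aliveCount B x k := by
      intro k
      simp only [aliveCount, g, Set.indicator_apply, Pi.one_apply]
      push_cast
      rfl
    have h0 : Tendsto (fun n : ℕ => (∑ i ∈ Finset.range n, g (x i)) / (n : ℝ)) atTop (𝓝 0) := by
      refine squeeze_zero (fun n => ?_) (fun n => ?_)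
        (tendsto_const_div_atTop_nhds_zero_nat (N : ℝ))
      · rw [hcount]; positivity
      · rw [hcount]
        have : (aliveCount B x n : ℝ) ≤ N := by exact_mod_cast (hlt n).le
        gcongr
    exact hνB.ne' (tendsto_nhds_unique hx h0)
  · refine Integrable.of_bound (hgm.comp (measurable_pi_apply 0)).aestronglyMeasurable 1
      (ae_of_all _ fun x => ?_)
    by_cases hy : x 0 ∈ B <;> simp [g, hy]

/-- The constant in the fourth moment bound for the error of one generation. -/
noncomputable def localConst (c : ℝ) : ℝ :=
  8 * (16 * (4 * ((3 + 16 / c * (2 / c + 1)) / c) + 1))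

lemma localConst_pos {c : ℝ} (hc : 0 < c) : 0 < localConst c := by
  unfold localConst; positivity

lemma lintegral_particleMean_sub_pow_four_le {B : Set S} (hB : MeasurableSet B) {c : ℝ}
    (hc : 0 < c) (hνB : c ≤ ν.real B) {N : ℕ} (hN : 2 ≤ N) {f : S → ℝ} (hf : Measurable f) {b : ℝ}
    (hfb : ∀ y, |f y| ≤ b) :
    ∫⁻ x, ENNReal.ofReal ((particleMean N B x f - ∫ y, f y ∂ν) ^ 4)
      ∂(Measure.infinitePi fun _ : ℕ => ν) ≤
        ENNReal.ofReal (localConst c * b ^ 4 / ((N : ℝ) - 1) ^ 2) := by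
  have hfi : Integrable f ν := Integrable.of_bound hf.aestronglyMeasurable b (ae_of_all _ hfb)
  obtain ⟨s₀⟩ : Nonempty S := nonempty_of_isProbabilityMeasure ν
  have hb : 0 ≤ b := (abs_nonneg _).trans (hfb s₀)
  have hνf : |∫ y, f y ∂ν| ≤ b := by
    simpa using norm_integral_le_of_norm_le_const (μ := ν) (f := f) (ae_of_all _ hfb)
  set d := 2 * b with hd
  let ξ : S → ℝ := fun y => f y - ∫ y, f y ∂ν
  have hξ : Measurable ξ := hf.sub_const _
  have hξd : ∀ y, |ξ y| ≤ d := fun y => (abs_sub _ _).trans (by linarith [hfb y])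
  have hξ0 : ∫ y, ξ y ∂ν = 0 := by
    simp only [ξ]
    rw [integral_sub hfi (integrable_const _)]; simp
  have hN' : (1 : ℝ) ≤ (N : ℝ) - 1 := by
    have : (2 : ℝ) ≤ N := by exact_mod_cast hN
    linarith
  set P := Measure.infinitePi fun _ : ℕ => ν
  let w : ℕ → (ℕ → S) → ℝ := fun k x =>
    8 / ((N : ℝ) - 1) ^ 4 * (walkEnergy c d (stoppedWalk B ξ N x k) + d ^ 4)
  have hpt : ∀ x, Stops N B x → ∀ k, stopIndex N B x ≤ k →
      (particleMean N B x f - ∫ y, f y ∂ν) ^ 4 ≤ w k x := by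
    intro x hx k hk
    have hT : (N : ℝ) ≤ stopIndex N B x := by exact_mod_cast hx.stopIndex_mem.1
    rw [hx.particleMean_sub hN, particleMean, div_pow]
    set t := stopIndex N B x with ht
    -- The supermartingale controls the sum up to `T`, while the estimate stops at `T - 1`: the last
    -- increment, bounded by `d`, is removed by hand.
    have hsum : ∑ i ∈ Finset.range (t - 1), ξ (x i) =
        (∑ i ∈ Finset.range t, ξ (x i)) - ξ (x (t - 1)) := by
      have : t = t - 1 + 1 := by have := hx.stopIndex_mem.1; omega
      conv_rhs => rw [this, Finset.sum_range_succ]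
      simp
    have hE : (∑ i ∈ Finset.range t, ξ (x i)) ^ 4 ≤
        walkEnergy c d (stoppedWalk B ξ N x k) := by
      rw [hx.stoppedWalk_eq ξ hk, walkEnergy]
      simp [ht]
    have h4 : (∑ i ∈ Finset.range (t - 1), ξ (x i)) ^ 4 ≤
        8 * (walkEnergy c d (stoppedWalk B ξ N x k) + d ^ 4) := by
      rw [hsum]
      set s := ∑ i ∈ Finset.range t, ξ (x i)
      set e := ξ (x (t - 1))
      have he : e ^ 4 ≤ d ^ 4 := by
        rw [← (show Even 4 by decide).pow_abs e]
        exact pow_le_pow_left₀ (abs_nonneg _) (hξd _) 4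
      have : (s - e) ^ 4 ≤ 8 * (s ^ 4 + e ^ 4) := by
        have h1 : (s - e) ^ 2 ≤ 2 * (s ^ 2 + e ^ 2) := by nlinarith [sq_nonneg (s + e)]
        have h2 : ((s - e) ^ 2) ^ 2 ≤ (2 * (s ^ 2 + e ^ 2)) ^ 2 :=
          pow_le_pow_left₀ (sq_nonneg _) h1 2
        nlinarith [sq_nonneg (s ^ 2 - e ^ 2)]
      linarith
    calc (∑ i ∈ Finset.range (t - 1), ξ (x i)) ^ 4 / ((t : ℝ) - 1) ^ 4
        ≤ (8 * (walkEnergy c d (stoppedWalk B ξ N x k) + d ^ 4)) / ((N : ℝ) - 1) ^ 4 := by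
          have : 0 ≤ walkEnergy c d (stoppedWalk B ξ N x k) := walkEnergy_nonneg hc d _
          gcongr
      _ = w k x := by simp only [w]; ring
  have hwm : ∀ k, Measurable (w k) := fun k =>
    (((measurable_walkEnergy c d).comp (measurable_stoppedWalk hB hξ N k)).add_const _).const_mul _
  have hint : ∀ k, ∫⁻ x, ENNReal.ofReal (w k x) ∂P ≤
      ENNReal.ofReal (localConst c * b ^ 4 / ((N : ℝ) - 1) ^ 2) := by
    intro k
    have h8 : (0 : ℝ) ≤ 8 / ((N : ℝ) - 1) ^ 4 := by positivity
    simp only [w, ENNReal.ofReal_mul h8]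
    rw [lintegral_const_mul' _ _ ENNReal.ofReal_ne_top]
    have : ∀ x, ENNReal.ofReal (walkEnergy c d (stoppedWalk B ξ N x k) + d ^ 4) =
        ENNReal.ofReal (walkEnergy c d (stoppedWalk B ξ N x k)) + ENNReal.ofReal (d ^ 4) :=
      fun x => ENNReal.ofReal_add (walkEnergy_nonneg hc d _) (by positivity)
    simp only [this]
    rw [lintegral_add_right _ measurable_const, lintegral_const]
    simp only [measure_univ, mul_one]
    refine (mul_le_mul_right (add_le_add_left
      (lintegral_walkEnergy_le ν hB hc hνB (by positivity) hξ hξd hξ0 N k) _) _).trans ?_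
    rw [← ENNReal.ofReal_add (walkEnergy_nonneg hc d _) (by positivity), ← ENNReal.ofReal_mul h8]
    refine ENNReal.ofReal_le_ofReal ?_
    -- The factors of `localConst`: `16` is `(d / b) ^ 4`, `4` is from `N ≤ 2 * (N - 1)`, and `8` is
    -- from the fourth power of a difference.
    have hV : walkEnergy c d (0, N) = 16 * b ^ 4 * ((3 + 16 / c * (2 / c + 1)) / c) * N ^ 2 := by
      simp only [walkEnergy, hd]; field_simp; ring
    have hN2 : (N : ℝ) ^ 2 ≤ 4 * ((N : ℝ) - 1) ^ 2 := by nlinarith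
    have hd4 : d ^ 4 ≤ 16 * b ^ 4 * ((N : ℝ) - 1) ^ 2 := by
      have : (1 : ℝ) ≤ ((N : ℝ) - 1) ^ 2 := one_le_pow₀ hN'
      calc d ^ 4 = 16 * b ^ 4 * 1 := by rw [hd]; ring
        _ ≤ _ := by gcongr
    calc 8 / ((N : ℝ) - 1) ^ 4 * (walkEnergy c d (0, N) + d ^ 4)
        ≤ 8 / ((N : ℝ) - 1) ^ 4 * (16 * b ^ 4 * ((3 + 16 / c * (2 / c + 1)) / c) *
            (4 * ((N : ℝ) - 1) ^ 2) + 16 * b ^ 4 * ((N : ℝ) - 1) ^ 2) := by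
          rw [hV]; gcongr
      _ = localConst c * b ^ 4 / ((N : ℝ) - 1) ^ 2 := by
          have : (N : ℝ) - 1 ≠ 0 := by linarith
          rw [localConst]; field_simp
  -- The walk is frozen from `T` on, so almost surely `w k x` dominates the error for all large `k`;
  -- Fatou's lemma then passes the uniform bound to the limit.
  calc ∫⁻ x, ENNReal.ofReal ((particleMean N B x f - ∫ y, f y ∂ν) ^ 4) ∂P
      ≤ ∫⁻ x, liminf (fun k => ENNReal.ofReal (w k x)) atTop ∂P := by
        refine lintegral_mono_ae ?_
        filter_upwards [ae_stops ν hB (hc.trans_le hνB) N] with x hx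
        refine le_liminf_of_le (by isBoundedDefault) ?_
        filter_upwards [eventually_ge_atTop (stopIndex N B x)] with k hk
        exact ENNReal.ofReal_le_ofReal (hpt x hx k hk)
    _ ≤ liminf (fun k => ∫⁻ x, ENNReal.ofReal (w k x) ∂P) atTop :=
        lintegral_liminf_le fun k => (hwm k).ennreal_ofReal
    _ ≤ liminf (fun _ : ℕ => ENNReal.ofReal (localConst c * b ^ 4 / ((N : ℝ) - 1) ^ 2)) atTop :=
        liminf_le_liminf (Eventually.of_forall hint)
    _ = _ := liminf_const _

end LocalError

/-! ### Sampling error after weighting and selection. -/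

section Selection

variable {S : Type*}

lemma particleMean_add (N : ℕ) (B : Set S) (x : ℕ → S) (f g : S → ℝ) :
    particleMean N B x (fun y => f y + g y) = particleMean N B x f + particleMean N B x g := by
  rw [particleMean, particleMean, particleMean, Finset.sum_add_distrib, add_div]

lemma particleMean_const_mul (N : ℕ) (B : Set S) (x : ℕ → S) (a : ℝ) (f : S → ℝ) :
    particleMean N B x (fun y => a * f y) = a * particleMean N B x f := by
  rw [particleMean, particleMean, ← Finset.mul_sum, mul_div_assoc]

lemma Stops.stopIndex_sub_one_pos {N : ℕ} (hN : 2 ≤ N) {B : Set S} {x : ℕ → S}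
    (h : Stops N B x) : (0 : ℝ) < (stopIndex N B x : ℝ) - 1 := by
  have : (2 : ℝ) ≤ stopIndex N B x := by exact_mod_cast hN.trans h.stopIndex_mem.1
  linarith

lemma Stops.particleMean_mono {N : ℕ} (hN : 2 ≤ N) {B : Set S} {x : ℕ → S} (h : Stops N B x)
    {f g : S → ℝ} (hfg : ∀ y, f y ≤ g y) : particleMean N B x f ≤ particleMean N B x g := by
  have := h.stopIndex_sub_one_pos hN
  unfold particleMean
  gcongr
  exact hfg _

lemma Stops.particleMean_indicator_mul_pos {N : ℕ} (hN : 2 ≤ N) {B : Set S} {x : ℕ → S}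
    (h : Stops N B x) {f : S → ℝ} (hf : ∀ y, 0 < f y) :
    0 < particleMean N B x fun y => B.indicator 1 y * f y := by
  classical
  refine div_pos ?_ (h.stopIndex_sub_one_pos hN)
  have hcount := h.aliveCount_pred (by omega)
  obtain ⟨i, hi, hiB⟩ : ∃ i ∈ Finset.range (stopIndex N B x - 1), x i ∈ B := by
    by_contra! hne
    have : aliveCount B x (stopIndex N B x - 1) = 0 := by
      rw [aliveCount]
      exact Finset.sum_eq_zero fun i hi => if_neg (hne i hi)
    omega
  refine Finset.sum_pos' (fun j _ => mul_nonneg ?_ (hf _).le) ⟨i, hi, ?_⟩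
  · exact Set.indicator_nonneg (fun _ _ => zero_le_one) _
  · simpa [hiB] using hf (x i)

/-- The empirical mean after selection by the potential `𝟙_B h`. -/
noncomputable def selectedMean (N : ℕ) (B : Set S) (h φ : S → ℝ) (x : ℕ → S) : ℝ :=
  particleMean N B x (fun y => B.indicator 1 y * (h y * φ y)) /
    particleMean N B x fun y => B.indicator 1 y * h y

lemma abs_le_of_osc {φ : S → ℝ} {r : ℝ} (hr : ∀ x y, φ x - φ y ≤ r) (x y : S) :
    |φ y| ≤ |φ x| + r := by
  have h1 := hr x y
  have h2 := hr y x
  have h3 := le_abs_self (φ x)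
  have h4 := neg_abs_le (φ x)
  rw [_root_.abs_le]
  constructor <;> linarith

lemma abs_indicator_one_mul_le (B : Set S) (a : ℝ) (y : S) :
    |B.indicator (1 : S → ℝ) y * a| ≤ |a| := by
  by_cases hy : y ∈ B <;> simp [hy]

variable [MeasurableSpace S]

/-- The number of summands is random but takes countably many values, so it can be frozen. -/
lemma measurable_particleMean (N : ℕ) {B : Set S} (hB : MeasurableSet B) {f : S → ℝ}
    (hf : Measurable f) : Measurable fun x : ℕ → S => particleMean N B x f := by
  have hT := measurable_stopIndex N hB
  have h : Measurable fun z : ℕ × (ℕ → S) => ∑ i ∈ Finset.range (z.1 - 1), f (z.2 i) :=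
    measurable_from_prod_countable_right fun t =>
      Finset.measurable_sum (Finset.range (t - 1)) fun i _ => hf.comp (measurable_pi_apply i)
  exact (h.comp (hT.prodMk measurable_id)).div
    (((measurable_from_nat (f := fun n => (n : ℝ))).comp hT).sub_const 1)

lemma measurable_selectedMean (N : ℕ) {B : Set S} (hB : MeasurableSet B) {h φ : S → ℝ}
    (hh : Measurable h) (hφ : Measurable φ) : Measurable (selectedMean N B h φ) := by
  have hg : Measurable (B.indicator (1 : S → ℝ)) := measurable_one.indicator hB
  exact (measurable_particleMean N hB (hg.mul (hh.mul hφ))).div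
    (measurable_particleMean N hB (hg.mul hh))

lemma measurableSet_stops (N : ℕ) {B : Set S} (hB : MeasurableSet B) :
    MeasurableSet {x : ℕ → S | Stops N B x} := by
  have : {x : ℕ → S | Stops N B x} = ⋃ k, {x | N ≤ aliveCount B x k} := by
    ext x; simp [Stops]
  rw [this]
  exact MeasurableSet.iUnion fun k => measurableSet_le measurable_const (measurable_aliveCount hB k)

/-- A positive weight with ratios of values bounded below by `δ`. -/
structure IsWeight (δ : ℝ) (h : S → ℝ) : Prop where
  measurable : Measurable h
  pos : ∀ x, 0 < h x
  mul_le : ∀ x y, δ * h y ≤ h x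

lemma IsWeight.abs_le {δ : ℝ} (hδ : 0 < δ) {h : S → ℝ} (hh : IsWeight δ h) (x y : S) :
    |h y| ≤ h x / δ := by
  rw [abs_of_pos (hh.pos y), le_div_iff₀' hδ]
  exact hh.mul_le x y

/-- The constant in the fourth moment bound for the error after selection. -/
noncomputable def selectionConst (c δ : ℝ) : ℝ := 16 * (localConst c * (1 / (c * δ)) ^ 4)

/-- With the normalized weight `w`, `ν(w) = 1`, and `f = w * (φ - q)`, `ν(f) = 0`, the error `e` of
the ratio satisfies `e = f̂ - e * (ŵ - 1)`, where hats are particle means. As `|e| ≤ r` surely, two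
applications of the unweighted bound suffice and no inverse moment of the denominator is needed. -/
lemma lintegral_selectedMean_sub_pow_four_le (ν : Measure S) [IsProbabilityMeasure ν] {B : Set S}
    (hB : MeasurableSet B) {c δ : ℝ} (hc : 0 < c) (hδ : 0 < δ) (hνB : c ≤ ν.real B) {N : ℕ}
    (hN : 2 ≤ N) {h φ : S → ℝ} (hh : IsWeight δ h) (hφ : Measurable φ) {r : ℝ}
    (hr : ∀ x y, φ x - φ y ≤ r) :
    ∫⁻ x, ENNReal.ofReal ((selectedMean N B h φ x -
        (∫ y, B.indicator 1 y * (h y * φ y) ∂ν) / ∫ y, B.indicator 1 y * h y ∂ν) ^ 4)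
      ∂(Measure.infinitePi fun _ : ℕ => ν) ≤
        ENNReal.ofReal (selectionConst c δ * r ^ 4 / ((N : ℝ) - 1) ^ 2) := by
  obtain ⟨s₀⟩ : Nonempty S := nonempty_of_isProbabilityMeasure ν
  have hr0 : 0 ≤ r := by simpa using hr s₀ s₀
  set g : S → ℝ := B.indicator 1 with hg
  have hgm : Measurable g := measurable_one.indicator hB
  have hg0 : ∀ y, 0 ≤ g y := fun y => Set.indicator_nonneg (fun _ _ => zero_le_one) y
  have hg1 : ∀ y, g y ≤ 1 := fun y => Set.indicator_le_self' (fun _ _ => zero_le_one) y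
  have hhm := hh.measurable
  have hghi : Integrable (fun y => g y * h y) ν :=
    Integrable.of_bound (hgm.mul hhm).aestronglyMeasurable (h s₀ / δ) (ae_of_all _ fun y =>
      (abs_indicator_one_mul_le B _ y).trans (hh.abs_le hδ s₀ y))
  have hghφi : Integrable (fun y => g y * (h y * φ y)) ν :=
    Integrable.of_bound (hgm.mul (hhm.mul hφ)).aestronglyMeasurable (h s₀ / δ * (|φ s₀| + r))
      (ae_of_all _ fun y => (abs_indicator_one_mul_le B _ y).trans (by
        rw [abs_mul]
        exact mul_le_mul (hh.abs_le hδ s₀ y) (abs_le_of_osc hr s₀ y) (abs_nonneg _)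
          (div_nonneg (hh.pos s₀).le hδ.le)))
  set Z := ∫ y, g y * h y ∂ν with hZ
  set q := (∫ y, g y * (h y * φ y) ∂ν) / Z with hq
  have hgi : Integrable g ν := (integrable_const 1).indicator hB
  have hgint : ∫ y, g y ∂ν = ν.real B := integral_indicator_one hB
  -- This makes `w` bounded by `1 / (c * δ)`, whatever the scale of `h`.
  have hZle : ∀ x, c * δ * h x ≤ Z := by
    intro x
    have h1 : ∫ y, δ * h x * g y ∂ν ≤ Z := by
      refine integral_mono (hgi.const_mul _) hghi fun y => ?_
      have := mul_le_mul_of_nonneg_left (hh.mul_le y x) (hg0 y)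
      simp only []
      linarith
    rw [integral_const_mul, hgint] at h1
    have h2 : δ * h x * c ≤ δ * h x * ν.real B :=
      mul_le_mul_of_nonneg_left hνB (mul_nonneg hδ.le (hh.pos x).le)
    linarith
  have hZ0 : 0 < Z := lt_of_lt_of_le (by have := hh.pos s₀; positivity) (hZle s₀)
  have hqZ : ∫ y, g y * (h y * φ y) ∂ν = q * Z := by rw [hq]; field_simp
  have hψ : ∀ x, |φ x - q| ≤ r := by
    intro x
    have h1 : ∫ y, g y * (h y * φ y) ∂ν ≤ (φ x + r) * Z := by
      rw [hZ, ← integral_const_mul]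
      refine integral_mono hghφi (hghi.const_mul _) fun y => ?_
      have := mul_le_mul_of_nonneg_left (hr y x) (mul_nonneg (hg0 y) (hh.pos y).le)
      simp only []
      linarith
    have h2 : (φ x - r) * Z ≤ ∫ y, g y * (h y * φ y) ∂ν := by
      rw [hZ, ← integral_const_mul]
      refine integral_mono (hghi.const_mul _) hghφi fun y => ?_
      have := mul_le_mul_of_nonneg_left (hr x y) (mul_nonneg (hg0 y) (hh.pos y).le)
      simp only []
      linarith
    rw [hqZ] at h1 h2
    have h3 := le_of_mul_le_mul_right h1 hZ0
    have h4 := le_of_mul_le_mul_right h2 hZ0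
    rw [_root_.abs_le]
    constructor <;> linarith
  set W := 1 / (c * δ) with hW
  have hW0 : 0 < W := by positivity
  let w : S → ℝ := fun y => Z⁻¹ * (g y * h y)
  have hwm : Measurable w := (hgm.mul hhm).const_mul _
  have hw0 : ∀ y, 0 ≤ w y := fun y =>
    mul_nonneg (inv_nonneg.2 hZ0.le) (mul_nonneg (hg0 y) (hh.pos y).le)
  have hwW : ∀ y, w y ≤ W := by
    intro y
    have h1 : g y * h y ≤ h y := mul_le_of_le_one_left (hh.pos y).le (hg1 y)
    have h2 := hZle y
    simp only [w, hW]
    rw [inv_mul_le_iff₀ hZ0, mul_one_div, le_div_iff₀ (by positivity)]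
    nlinarith [mul_le_mul_of_nonneg_right h1 (mul_pos hc hδ).le]
  have hw_abs : ∀ y, |w y| ≤ W := fun y => by rw [abs_of_nonneg (hw0 y)]; exact hwW y
  let f : S → ℝ := fun y => w y * (φ y - q)
  have hfm : Measurable f := hwm.mul (hφ.sub_const _)
  have hfW : ∀ y, |f y| ≤ W * r := fun y => by
    simp only [f]
    rw [abs_mul]
    exact mul_le_mul (hw_abs y) (hψ y) (abs_nonneg _) hW0.le
  have hwint : ∫ y, w y ∂ν = 1 := by
    simp only [w]
    rw [integral_const_mul]
    exact inv_mul_cancel₀ hZ0.ne'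
  have hfeq : ∀ y, f y = Z⁻¹ * (g y * (h y * φ y)) + -q * Z⁻¹ * (g y * h y) := fun y => by
    simp only [f, w]; ring
  have hfint : ∫ y, f y ∂ν = 0 := by
    simp only [hfeq]
    rw [integral_add (hghφi.const_mul _) (hghi.const_mul _), integral_const_mul,
      integral_const_mul, hqZ, ← hZ]
    ring
  set P := Measure.infinitePi fun _ : ℕ => ν
  have hpt : ∀ x, Stops N B x → (selectedMean N B h φ x - q) ^ 4 ≤
      8 * ((particleMean N B x f - ∫ y, f y ∂ν) ^ 4 +
        r ^ 4 * (particleMean N B x w - ∫ y, w y ∂ν) ^ 4) := by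
    intro x hx
    rw [hfint, hwint, sub_zero]
    have hm0 : 0 < particleMean N B x fun y => g y * h y :=
      hx.particleMean_indicator_mul_pos hN hh.pos
    have hmw : particleMean N B x w = Z⁻¹ * particleMean N B x fun y => g y * h y :=
      particleMean_const_mul ..
    have hmw0 : 0 < particleMean N B x w := by rw [hmw]; positivity
    have hmf : particleMean N B x f = (selectedMean N B h φ x - q) * particleMean N B x w := by
      have : f = fun y => Z⁻¹ * (g y * (h y * φ y)) + -q * Z⁻¹ * (g y * h y) := funext hfeq
      rw [this, particleMean_add, particleMean_const_mul, particleMean_const_mul, hmw,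
        selectedMean, ← hg, sub_mul, div_mul_eq_mul_div, mul_left_comm, mul_div_assoc,
        mul_div_cancel_right₀ _ hm0.ne']
      ring
    have hle : |particleMean N B x f| ≤ r * particleMean N B x w := by
      rw [_root_.abs_le, ← neg_mul, ← particleMean_const_mul, ← particleMean_const_mul]
      constructor <;> refine hx.particleMean_mono hN fun y => ?_
      · have := mul_le_mul_of_nonneg_left (_root_.abs_le.1 (hψ y)).1 (hw0 y)
        simp only [f]; linarith
      · have := mul_le_mul_of_nonneg_left (_root_.abs_le.1 (hψ y)).2 (hw0 y)
        simp only [f]; linarith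
    set e := selectedMean N B h φ x - q
    set m := particleMean N B x w
    -- Both ratios are weighted averages of `φ`, so they differ by at most its oscillation.
    have he : |e| ≤ r := by
      rw [hmf, abs_mul, abs_of_pos hmw0] at hle
      exact le_of_mul_le_mul_right hle hmw0
    have he4 : e ^ 4 ≤ r ^ 4 := by
      rw [← (show Even 4 by decide).pow_abs e]
      exact pow_le_pow_left₀ (abs_nonneg _) he 4
    have h4 : ∀ a b : ℝ, (a - b) ^ 4 ≤ 8 * (a ^ 4 + b ^ 4) := by
      intro a b
      have h1 : (a - b) ^ 2 ≤ 2 * (a ^ 2 + b ^ 2) := by nlinarith [sq_nonneg (a + b)]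
      have h2 : ((a - b) ^ 2) ^ 2 ≤ (2 * (a ^ 2 + b ^ 2)) ^ 2 :=
        pow_le_pow_left₀ (sq_nonneg _) h1 2
      nlinarith [sq_nonneg (a ^ 2 - b ^ 2)]
    have h5 := h4 (particleMean N B x f) (e * (m - 1))
    have h6 : particleMean N B x f - e * (m - 1) = e := by rw [hmf]; ring
    rw [h6, mul_pow] at h5
    have h7 := mul_le_mul_of_nonneg_right he4 ((show Even 4 by decide).pow_nonneg (m - 1))
    linarith
  have hN' : (1 : ℝ) ≤ (N : ℝ) - 1 := by
    have : (2 : ℝ) ≤ N := by exact_mod_cast hN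
    linarith
  have hf4 := lintegral_particleMean_sub_pow_four_le ν hB hc hνB hN hfm hfW
  have hw4 := lintegral_particleMean_sub_pow_four_le ν hB hc hνB hN hwm hw_abs
  have hK := localConst_pos hc
  calc ∫⁻ x, ENNReal.ofReal ((selectedMean N B h φ x - q) ^ 4) ∂P
      ≤ ∫⁻ x, (ENNReal.ofReal 8 * ENNReal.ofReal ((particleMean N B x f - ∫ y, f y ∂ν) ^ 4) +
          ENNReal.ofReal (8 * r ^ 4) *
            ENNReal.ofReal ((particleMean N B x w - ∫ y, w y ∂ν) ^ 4)) ∂P := by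
        refine lintegral_mono_ae ?_
        filter_upwards [ae_stops ν hB (hc.trans_le hνB) N] with x hx
        have hE : ∀ a : ℝ, 0 ≤ a ^ 4 := fun a => (show Even 4 by decide).pow_nonneg a
        rw [← ENNReal.ofReal_mul (by norm_num), ← ENNReal.ofReal_mul (by positivity),
          ← ENNReal.ofReal_add (mul_nonneg (by norm_num) (hE _))
            (mul_nonneg (by positivity) (hE _))]
        refine ENNReal.ofReal_le_ofReal ((hpt x hx).trans_eq ?_)
        ring
    _ ≤ ENNReal.ofReal 8 * ENNReal.ofReal (localConst c * (W * r) ^ 4 / ((N : ℝ) - 1) ^ 2) +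
          ENNReal.ofReal (8 * r ^ 4) *
            ENNReal.ofReal (localConst c * W ^ 4 / ((N : ℝ) - 1) ^ 2) := by
        rw [lintegral_add_left, lintegral_const_mul' _ _ ENNReal.ofReal_ne_top,
          lintegral_const_mul' _ _ ENNReal.ofReal_ne_top]
        · gcongr
        · exact ((((measurable_particleMean N hB hfm).sub_const _).pow_const 4).ennreal_ofReal
            ).const_mul _
    _ = ENNReal.ofReal (selectionConst c δ * r ^ 4 / ((N : ℝ) - 1) ^ 2) := by
        rw [← ENNReal.ofReal_mul (by norm_num), ← ENNReal.ofReal_mul (by positivity),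
          ← ENNReal.ofReal_add (by positivity) (by positivity), selectionConst]
        congr 1
        ring

variable {S' : Type*} [MeasurableSpace S']

lemma Stops.integral_empirical {N : ℕ} (hN : 2 ≤ N) {B : Set S} {x : ℕ → S} (h : Stops N B x)
    {f : S → ℝ} (hf : Measurable f) : ∫ y, f y ∂empirical N B x = particleMean N B x f := by
  have h2 : 1 ≤ stopIndex N B x := by have := h.stopIndex_mem.1; omega
  rw [empirical, integral_smul_measure, integral_finsetSum_measure]
  · simp only [integral_dirac' f _ hf.stronglyMeasurable, particleMean, smul_eq_mul,
      ENNReal.toReal_inv, ENNReal.toReal_natCast]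
    rw [Nat.cast_sub h2, Nat.cast_one, div_eq_inv_mul]
  · intro i _
    exact integrable_dirac' hf.stronglyMeasurable (by simp)

/-- When sampling stops and `N ≥ 2`, the empirical measure charges `B`, so the default branch of
`nextLaw` is excluded. -/
lemma Stops.integral_nextLaw {N : ℕ} (hN : 2 ≤ N) {B : Set S} (hB : MeasurableSet B)
    {M : Kernel S S'} [IsMarkovKernel M] {x : ℕ → S} (h : Stops N B x) {f : S' → ℝ}
    (hf : Measurable f) {K : ℝ} (hK : ∀ y, |f y| ≤ K) :
    ∫ y, f y ∂nextLaw N B M x =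
      particleMean N B x (fun z => B.indicator 1 z * ∫ y, f y ∂M z) /
        particleMean N B x (B.indicator 1) := by
  have hfin := isFiniteMeasure_empirical N B x
  have hgm : Measurable (B.indicator (1 : S → ℝ)) := measurable_one.indicator hB
  have hMf : Measurable fun z => ∫ y, f y ∂M z :=
    (StronglyMeasurable.integral_kernel (κ := M) hf.stronglyMeasurable).measurable
  have hgMf : Measurable fun z => B.indicator 1 z * ∫ y, f y ∂M z := hgm.mul hMf
  have hEB : (empirical N B x).real B = particleMean N B x (B.indicator 1) := by
    rw [← h.integral_empirical hN hgm]
    exact (integral_indicator_one hB).symm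
  have hpos : 0 < (empirical N B x).real B := by
    rw [hEB]
    simpa using h.particleMean_indicator_mul_pos hN (f := fun _ => 1) fun _ => one_pos
  have hne : empirical N B x B ≠ 0 := fun h0 => by simp [Measure.real, h0] at hpos
  rw [nextLaw, if_neg hne]
  have := cond_isProbabilityMeasure hne
  have hcomp : ∫ y, f y ∂((empirical N B x)[|B]).bind M =
      ∫ z, ∫ y, f y ∂M z ∂(empirical N B x)[|B] :=
    Kernel.integral_comp (κ := Kernel.const Unit ((empirical N B x)[|B])) (η := M) (a := ())
      (Integrable.of_bound hf.aestronglyMeasurable K (ae_of_all _ hK))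
  rw [hcomp, ProbabilityTheory.cond, integral_smul_measure, ← integral_indicator hB, ENNReal.toReal_inv,
    ← h.integral_empirical hN hgMf, ← hEB, smul_eq_mul, div_eq_inv_mul]
  congr 1
  refine integral_congr_ae (ae_of_all _ fun z => ?_)
  by_cases hz : z ∈ B <;> simp [hz]

/-- Both branches of `nextLaw` are mixtures of the laws `M z`, so the bound needs no condition on
the past. -/
lemma le_nextLaw_real (N : ℕ) {B : Set S} {M : Kernel S S'} [IsMarkovKernel M] (x : ℕ → S)
    {A : Set S'} (hA : MeasurableSet A) {c : ℝ} (hc : ∀ z, c ≤ (M z).real A) :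
    c ≤ (nextLaw N B M x).real A := by
  have hfin := isFiniteMeasure_empirical N B x
  by_cases h : empirical N B x B = 0
  · rw [nextLaw, if_pos h]
    exact hc _
  · have hp := cond_isProbabilityMeasure h
    have hp' := isProbabilityMeasure_nextLaw N B M x
    refine (ENNReal.ofReal_le_iff_le_toReal (measure_ne_top _ _)).1 ?_
    rw [nextLaw, if_neg h, Measure.bind_apply hA M.aemeasurable]
    calc ENNReal.ofReal c = ∫⁻ _, ENNReal.ofReal c ∂(empirical N B x)[|B] := by simp
      _ ≤ _ := lintegral_mono fun z =>
        (ENNReal.ofReal_le_iff_le_toReal (measure_ne_top _ _)).2 (hc z)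

end Selection

/-! ### Backward transport of weights and test functions, and its contraction. -/

section Backward

/-- The weight at time `n` obtained by transporting a weight at time `n + 1` backward. -/
noncomputable def pullWeight (F : FKModel E) (n : ℕ) (h : E (n + 1) → ℝ) : E n → ℝ :=
  F.mutate n fun y => F.G (n + 1) y * h y

/-- The test function at time `n` obtained by averaging a test function at time `n + 1`
with respect to the transition twisted by the weight. -/
noncomputable def pullFun (F : FKModel E) (n : ℕ) (h φ : E (n + 1) → ℝ) (x : E n) : ℝ :=
  F.mutate n (fun y => F.G (n + 1) y * (h y * φ y)) x / F.pullWeight n h x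

/-- The mean of `φ` with respect to the predictor twisted by the weight `G h`. -/
noncomputable def twistedMean (F : FKModel E) (n : ℕ) (h φ : E n → ℝ) : ℝ :=
  F.gamma n (fun x => F.G n x * (h x * φ x)) / F.gamma n fun x => F.G n x * h x

variable {F : FKModel E} {δ c : ℝ}

lemma mul_mutate_le (hδ : 0 < δ) {n : ℕ} (hM : ∀ x y : E n, ∀ A : Set (E (n + 1)),
      MeasurableSet A → δ * (F.M n y).real A ≤ (F.M n x).real A)
    {f : E (n + 1) → ℝ} (hf : Measurable f) {K : ℝ} (hK : ∀ y, |f y| ≤ K) (hf0 : ∀ y, 0 ≤ f y)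
    (x y : E n) : δ * F.mutate n f y ≤ F.mutate n f x := by
  have hle : ENNReal.ofReal δ • F.M n y ≤ F.M n x := by
    refine Measure.le_iff.2 fun A hA => ?_
    rw [Measure.smul_apply, smul_eq_mul, ← ofReal_measureReal (μ := F.M n y) (s := A),
      ← ofReal_measureReal (μ := F.M n x) (s := A), ← ENNReal.ofReal_mul hδ.le]
    exact ENNReal.ofReal_le_ofReal (hM x y A hA)
  have h := integral_mono_measure hle (ae_of_all _ hf0)
    (Integrable.of_bound hf.aestronglyMeasurable K (ae_of_all _ hK))
  rwa [integral_smul_measure, ENNReal.toReal_ofReal hδ.le, smul_eq_mul] at h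

lemma IsWeight.abs_G_mul_le {n : ℕ} (hδ : 0 < δ) {h : E n → ℝ} (hh : IsWeight δ h) (x y : E n) :
    |F.G n y * h y| ≤ h x / δ :=
  (F.abs_G_mul_le n y _).trans (hh.abs_le hδ x y)

lemma IsWeight.abs_G_mul_mul_le {n : ℕ} (hδ : 0 < δ) {h φ : E n → ℝ} (hh : IsWeight δ h) {r : ℝ}
    (hr : ∀ x y, φ x - φ y ≤ r) (x y : E n) :
    |F.G n y * (h y * φ y)| ≤ h x / δ * (|φ x| + r) := by
  refine (F.abs_G_mul_le n y _).trans ?_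
  rw [abs_mul]
  exact mul_le_mul (hh.abs_le hδ x y) (abs_le_of_osc hr x y) (abs_nonneg _)
    (div_nonneg (hh.pos x).le hδ.le)

lemma measurable_G_mul {n : ℕ} {h : E n → ℝ} (hh : Measurable h) :
    Measurable fun y => F.G n y * h y :=
  (F.measurable_G n).mul hh

lemma measurable_G_mul_mul {n : ℕ} {h φ : E n → ℝ} (hh : Measurable h) (hφ : Measurable φ) :
    Measurable fun y => F.G n y * (h y * φ y) :=
  (F.measurable_G n).mul (hh.mul hφ)

lemma nonempty_space (F : FKModel E) (n : ℕ) : Nonempty (E n) := by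
  induction n with
  | zero => exact ⟨F.x₀⟩
  | succ n ih =>
    obtain ⟨x⟩ := ih
    exact nonempty_of_isProbabilityMeasure (F.M n x)

/-- The ratio bound `δ` does not deteriorate: it comes afresh from the mixing of the last kernel.
The old bound serves only for positivity and integrability. -/
lemma IsWeight.pullWeight (hδ : 0 < δ) (hc : 0 < c) {n : ℕ} (hM : ∀ x y : E n,
      ∀ A : Set (E (n + 1)), MeasurableSet A → δ * (F.M n y).real A ≤ (F.M n x).real A)
    (hB : ∀ x, c ≤ (F.M n x).real (F.B (n + 1))) {h : E (n + 1) → ℝ} (hh : IsWeight δ h) :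
    IsWeight δ (F.pullWeight n h) := by
  obtain ⟨s₀⟩ := F.nonempty_space (n + 1)
  have hm : Measurable fun y => F.G (n + 1) y * h y := (F.measurable_G _).mul hh.measurable
  refine ⟨F.measurable_mutate n hm, fun x => ?_, fun x y => ?_⟩
  · have hG : Integrable (F.G (n + 1)) (F.M n x) :=
      (integrable_const 1).indicator (F.measurableSet_B _)
    have h1 : ∫ y, δ * h s₀ * F.G (n + 1) y ∂F.M n x ≤ F.pullWeight n h x := by
      refine integral_mono (hG.const_mul _) (Integrable.of_bound hm.aestronglyMeasurable _
        (ae_of_all _ (hh.abs_G_mul_le hδ s₀))) fun y => ?_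
      have := mul_le_mul_of_nonneg_left (hh.mul_le y s₀) (F.G_nonneg _ y)
      simp only []
      linarith
    have h2 : ∫ y, F.G (n + 1) y ∂F.M n x = (F.M n x).real (F.B (n + 1)) :=
      integral_indicator_one (F.measurableSet_B _)
    rw [integral_const_mul, h2] at h1
    exact (mul_pos (mul_pos hδ (hh.pos s₀)) (hc.trans_le (hB x))).trans_le h1
  · exact mul_mutate_le hδ hM hm (hh.abs_G_mul_le hδ s₀)
      (fun z => mul_nonneg (F.G_nonneg _ z) (hh.pos z).le) x y

lemma measurable_pullFun {n : ℕ} {h φ : E (n + 1) → ℝ} (hh : Measurable h) (hφ : Measurable φ) :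
    Measurable (F.pullFun n h φ) :=
  (F.measurable_mutate n ((F.measurable_G _).mul (hh.mul hφ))).div
    (F.measurable_mutate n ((F.measurable_G _).mul hh))

lemma pullWeight_mul_pullFun {n : ℕ} {h : E (n + 1) → ℝ} {x : E n}
    (hpos : 0 < F.pullWeight n h x) (φ : E (n + 1) → ℝ) :
    F.pullWeight n h x * F.pullFun n h φ x =
      F.mutate n (fun y => F.G (n + 1) y * (h y * φ y)) x :=
  mul_div_cancel₀ _ hpos.ne'

/-- After subtracting the infimum of `φ`, numerator and denominator are both integrals of
nonnegative functions. Each changes by a factor at least `δ` between two starting points, so the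
ratio at `y` is at least `δ ^ 2` times the ratio at `x`, which itself is at most `r`. -/
lemma pullFun_sub_le (hδ : 0 < δ) (hδ1 : δ < 1) (hc : 0 < c) {n : ℕ} (hM : ∀ x y : E n,
      ∀ A : Set (E (n + 1)), MeasurableSet A → δ * (F.M n y).real A ≤ (F.M n x).real A)
    (hB : ∀ x, c ≤ (F.M n x).real (F.B (n + 1))) {h φ : E (n + 1) → ℝ} (hh : IsWeight δ h)
    (hφ : Measurable φ) {r : ℝ} (hr : ∀ x y, φ x - φ y ≤ r) (x y : E n) :
    F.pullFun n h φ x - F.pullFun n h φ y ≤ (1 - δ ^ 2) * r := by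
  obtain ⟨s₀⟩ := F.nonempty_space (n + 1)
  have hW := hh.pullWeight hδ hc hM hB
  set m := ⨅ z, φ z
  have hbdd : BddBelow (Set.range φ) :=
    ⟨φ s₀ - r, by rintro _ ⟨z, rfl⟩; linarith [hr s₀ z]⟩
  have hm0 : ∀ z, 0 ≤ φ z - m := fun z => sub_nonneg.2 (ciInf_le hbdd z)
  have hmr : ∀ z, φ z - m ≤ r := fun z => by
    have : Nonempty (E (n + 1)) := ⟨s₀⟩
    have : φ z - r ≤ m := le_ciInf fun y => by linarith [hr z y]
    linarith
  have hr' : ∀ x y, (φ x - m) - (φ y - m) ≤ r := fun x y => by linarith [hr x y]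
  have hfm : Measurable fun y => F.G (n + 1) y * (h y * (φ y - m)) :=
    (F.measurable_G _).mul (hh.measurable.mul (hφ.sub_const _))
  have hgm : Measurable fun y => F.G (n + 1) y * h y := (F.measurable_G _).mul hh.measurable
  have hgm' : Measurable fun y => F.G (n + 1) y * (h y * φ y) :=
    (F.measurable_G _).mul (hh.measurable.mul hφ)
  have hf0 : ∀ y, 0 ≤ F.G (n + 1) y * (h y * (φ y - m)) := fun z =>
    mul_nonneg (F.G_nonneg _ z) (mul_nonneg (hh.pos z).le (hm0 z))
  have hgi : ∀ z, Integrable (fun y => F.G (n + 1) y * h y) (F.M n z) := fun z =>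
    Integrable.of_bound hgm.aestronglyMeasurable _ (ae_of_all _ (hh.abs_G_mul_le hδ s₀))
  have hgi' : ∀ z, Integrable (fun y => F.G (n + 1) y * (h y * φ y)) (F.M n z) := fun z =>
    Integrable.of_bound hgm'.aestronglyMeasurable _ (ae_of_all _ (hh.abs_G_mul_mul_le hδ hr s₀))
  have hfi : ∀ z, Integrable (fun y => F.G (n + 1) y * (h y * (φ y - m))) (F.M n z) := fun z =>
    Integrable.of_bound hfm.aestronglyMeasurable _ (ae_of_all _ (hh.abs_G_mul_mul_le hδ hr' s₀))
  set I : E n → ℝ := F.mutate n fun y => F.G (n + 1) y * (h y * (φ y - m)) with hI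
  have hIeq : ∀ z, F.pullFun n h φ z - m = I z / F.pullWeight n h z := by
    intro z
    have : I z = F.mutate n (fun y => F.G (n + 1) y * (h y * φ y)) z -
        m * F.pullWeight n h z := by
      rw [hI, mutate, mutate, FKModel.pullWeight, mutate, ← integral_const_mul,
        ← integral_sub (hgi' z) ((hgi z).const_mul _)]
      congr 1
      ext y
      ring
    rw [this, sub_div, mul_div_cancel_right₀ _ (hW.pos z).ne']
    rfl
  have hIle : I x ≤ r * F.pullWeight n h x := by
    rw [FKModel.pullWeight, mutate, ← integral_const_mul]
    refine integral_mono (hfi x) ((hgi x).const_mul _) fun z => ?_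
    have := mul_le_mul_of_nonneg_left (hmr z) (mul_nonneg (F.G_nonneg _ z) (hh.pos z).le)
    simp only []
    linarith
  have h1 : δ * I x ≤ I y := mul_mutate_le hδ hM hfm (hh.abs_G_mul_mul_le hδ hr' s₀) hf0 y x
  have h2 : δ * F.pullWeight n h y ≤ F.pullWeight n h x := hW.mul_le x y
  have hx := hW.pos x
  have hy := hW.pos y
  have hI0 : 0 ≤ I x := integral_nonneg hf0
  have h3 : δ ^ 2 * (I x / F.pullWeight n h x) ≤ I y / F.pullWeight n h y := by
    rw [mul_div_assoc', div_le_div_iff₀ hx hy]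
    calc δ ^ 2 * I x * F.pullWeight n h y = (δ * I x) * (δ * F.pullWeight n h y) := by ring
      _ ≤ I y * F.pullWeight n h x := by
        exact mul_le_mul h1 h2 (by positivity) ((mul_nonneg hδ.le hI0).trans h1)
  have h4 : I x / F.pullWeight n h x ≤ r := (div_le_iff₀ hx).2 hIle
  have h5 : F.pullFun n h φ x - F.pullFun n h φ y =
      I x / F.pullWeight n h x - I y / F.pullWeight n h y := by
    rw [← hIeq, ← hIeq]; ring
  have h6 : 0 ≤ 1 - δ ^ 2 := by nlinarith
  rw [h5]
  nlinarith [mul_le_mul_of_nonneg_left h4 h6]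

lemma twistedMean_succ (hδ : 0 < δ) (hc : 0 < c) {n : ℕ} (hn : 1 ≤ n) (hM : ∀ x y : E n,
      ∀ A : Set (E (n + 1)), MeasurableSet A → δ * (F.M n y).real A ≤ (F.M n x).real A)
    (hB : ∀ x, c ≤ (F.M n x).real (F.B (n + 1))) {h φ : E (n + 1) → ℝ} (hh : IsWeight δ h)
    (hφ : Measurable φ) {r : ℝ} (hr : ∀ x y, φ x - φ y ≤ r) :
    F.twistedMean (n + 1) h φ = F.twistedMean n (F.pullWeight n h) (F.pullFun n h φ) := by
  obtain ⟨s₀⟩ := F.nonempty_space (n + 1)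
  have hW := hh.pullWeight hδ hc hM hB
  rw [twistedMean, gamma_succ F hn (measurable_G_mul_mul hh.measurable hφ)
    (hh.abs_G_mul_mul_le hδ hr s₀), gamma_succ F hn (measurable_G_mul hh.measurable)
    (hh.abs_G_mul_le hδ s₀), twistedMean]
  simp only [pullWeight_mul_pullFun (hW.pos _)]
  rfl

lemma eta_succ (F : FKModel E) {n : ℕ} (hn : 1 ≤ n) {φ : E (n + 1) → ℝ} (hφ : Measurable φ)
    {K : ℝ} (hK : ∀ y, |φ y| ≤ K) :
    F.eta (n + 1) φ = F.twistedMean n 1 (F.mutate n φ) := by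
  have h1 : F.mutate n 1 = 1 := by
    ext x; simp [mutate]
  rw [eta, gamma_succ F hn hφ hK, gamma_succ F hn measurable_one (K := 1) (by simp), h1,
    twistedMean]
  simp

lemma eta_one (F : FKModel E) {φ : E 1 → ℝ} (hφ : Measurable φ) {K : ℝ} (hK : ∀ y, |φ y| ≤ K) :
    F.eta 1 φ = F.mutate 0 φ F.x₀ := by
  rw [eta, gamma_one F hφ hK, gamma_one F measurable_one (K := 1) (by simp)]
  simp [mutate]

/-- The particle counterpart of `twistedMean_succ`; the normalization `η(G)` of the sampling law
cancels in the ratio. -/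
lemma Stops.selection_eq (hδ : 0 < δ) (hc : 0 < c) {n : ℕ} (hM : ∀ x y : E n,
      ∀ A : Set (E (n + 1)), MeasurableSet A → δ * (F.M n y).real A ≤ (F.M n x).real A)
    (hB : ∀ x, c ≤ (F.M n x).real (F.B (n + 1))) {N : ℕ} (hN : 2 ≤ N) {x : ℕ → E n}
    (hx : Stops N (F.B n) x) {h φ : E (n + 1) → ℝ} (hh : IsWeight δ h)
    (hφ : Measurable φ) {r : ℝ} (hr : ∀ x y, φ x - φ y ≤ r) :
    (∫ y, F.G (n + 1) y * (h y * φ y) ∂nextLaw N (F.B n) (F.M n) x) /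
        (∫ y, F.G (n + 1) y * h y ∂nextLaw N (F.B n) (F.M n) x) =
      selectedMean N (F.B n) (F.pullWeight n h) (F.pullFun n h φ) x := by
  obtain ⟨s₀⟩ := F.nonempty_space (n + 1)
  have hW := hh.pullWeight hδ hc hM hB
  have hpos : 0 < particleMean N (F.B n) x ((F.B n).indicator 1) := by
    simpa using hx.particleMean_indicator_mul_pos hN (f := fun _ => 1) fun _ => one_pos
  rw [hx.integral_nextLaw hN (F.measurableSet_B n)
      (measurable_G_mul_mul hh.measurable hφ) (hh.abs_G_mul_mul_le hδ hr s₀),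
    hx.integral_nextLaw hN (F.measurableSet_B n)
      (measurable_G_mul hh.measurable) (hh.abs_G_mul_le hδ s₀),
    div_div_div_cancel_right₀ hpos.ne', selectedMean]
  simp only [pullWeight_mul_pullFun (hW.pos _)]
  rfl

lemma Stops.integral_nextLaw_eq {n : ℕ} {N : ℕ} (hN : 2 ≤ N) {x : ℕ → E n}
    (hx : Stops N (F.B n) x) {φ : E (n + 1) → ℝ} (hφ : Measurable φ) {K : ℝ}
    (hK : ∀ y, |φ y| ≤ K) :
    ∫ y, φ y ∂nextLaw N (F.B n) (F.M n) x = selectedMean N (F.B n) 1 (F.mutate n φ) x := by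
  rw [hx.integral_nextLaw hN (F.measurableSet_B n) hφ hK, selectedMean]
  simp
  rfl

end Backward

/-! ### Propagation of the errors, uniformly in time. -/

section Propagation

instance (F : FKModel E) (N : ℕ) : IsProbabilityMeasure (F.filterLaw N) := by
  unfold filterLaw; infer_instance

lemma lintegral_filterLaw_succ (F : FKModel E) (N n : ℕ)
    {f : (ℕ → E n) × (ℕ → E (n + 1)) → ENNReal} (hf : Measurable f) :
    ∫⁻ ω, f (ω n, ω (n + 1)) ∂F.filterLaw N =
      ∫⁻ ω, ∫⁻ y, f (ω n, y) ∂F.generationKernel N n (ω n) ∂F.filterLaw N := by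
  have hm : Measurable fun z : (Π i : Finset.Iic n, (ℕ → E i)) × (ℕ → E (n + 1)) =>
      f (z.1 ⟨n, Finset.mem_Iic.2 le_rfl⟩, z.2) :=
    hf.comp (((measurable_pi_apply _).comp measurable_fst).prodMk measurable_snd)
  exact lintegral_trajMeasure_succ (X := fun n => ℕ → E n)
    (μ₀ := Measure.dirac fun _ => F.x₀) (κ := F.filterKernel N) hm

lemma ae_filterLaw_zero (F : FKModel E) (N : ℕ) {p : (ℕ → E 0) → Prop}
    (hp : MeasurableSet {x | p x}) (h : p fun _ => F.x₀) : ∀ᵐ ω ∂F.filterLaw N, p (ω 0) := by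
  have hmap := map_zero_trajMeasure (X := fun n => ℕ → E n)
    (μ₀ := Measure.dirac fun _ => F.x₀) (κ := F.filterKernel N)
  have h0 : ∀ᵐ x ∂(F.filterLaw N).map (fun ω => ω 0), p x := by
    rw [filterLaw, hmap, ae_dirac_iff hp]
    exact h
  exact ae_of_ae_map (measurable_pi_apply 0).aemeasurable h0

variable {F : FKModel E} {δ c : ℝ}

lemma le_particleLaw_real (hB : ∀ n x, c ≤ (F.M n x).real (F.B (n + 1))) (N n : ℕ)
    (x : ℕ → E n) : c ≤ (F.particleLaw N n x).real (F.B (n + 1)) := by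
  cases n with
  | zero => exact hB 0 _
  | succ n => exact le_nextLaw_real N x (F.measurableSet_B _) (hB (n + 1))

lemma ae_stops_filterLaw (hc : 0 < c) (hB : ∀ n x, c ≤ (F.M n x).real (F.B (n + 1))) (N n : ℕ) :
    ∀ᵐ ω ∂F.filterLaw N, Stops N (F.B (n + 1)) (ω (n + 1)) := by
  have hs := measurableSet_stops N (F.measurableSet_B (n + 1))
  have h := F.lintegral_filterLaw_succ N n
    (f := fun z => {x | Stops N (F.B (n + 1)) x}ᶜ.indicator 1 z.2)
    ((measurable_one.indicator hs.compl).comp measurable_snd)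
  have hin : ∀ x : ℕ → E n, ∫⁻ y, {x | Stops N (F.B (n + 1)) x}ᶜ.indicator 1 y
      ∂F.generationKernel N n x = 0 := by
    intro x
    rw [lintegral_indicator_one hs.compl]
    exact ae_stops (F.particleLaw N n x) (F.measurableSet_B (n + 1))
      (hc.trans_le (le_particleLaw_real hB N n x)) N
  simp only [hin, lintegral_zero] at h
  have hm : Measurable fun ω : Π n, (ℕ → E n) =>
      {x | Stops N (F.B (n + 1)) x}ᶜ.indicator (1 : (ℕ → E (n + 1)) → ENNReal) (ω (n + 1)) :=
    (measurable_one.indicator hs.compl).comp (measurable_pi_apply _)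
  rw [lintegral_eq_zero_iff hm] at h
  filter_upwards [h] with ω hω
  by_contra hne
  simp [hne] at hω

lemma add_pow_four_le {t : ℝ} (ht0 : 0 < t) (ht1 : t < 1) (a b : ℝ) :
    (a + b) ^ 4 ≤ a ^ 4 / (1 - t) ^ 3 + b ^ 4 / t ^ 3 := by
  have ht : 0 < 1 - t := by linarith
  have h := ((show Even 4 by decide).convexOn_pow (𝕜 := ℝ)).2 (Set.mem_univ (a / (1 - t)))
    (Set.mem_univ (b / t)) ht.le ht0.le (by ring)
  simp only [smul_eq_mul] at h
  rw [mul_div_cancel₀ _ ht.ne', mul_div_cancel₀ _ ht0.ne'] at h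
  refine h.trans_eq ?_
  field_simp

/-- Here `u` is the fresh sampling error, bounded conditionally on generation `n`, and `v` the
inherited one. Convexity with weights `1 - t` and `t` avoids cross moments and leaves `t` free to
balance the two terms. -/
lemma lintegral_add_pow_four_le (N n : ℕ) {u : (ℕ → E n) × (ℕ → E (n + 1)) → ℝ}
    (hu : Measurable u) {v : (ℕ → E n) → ℝ} {a b t : ℝ} (ha : 0 ≤ a)
    (hb : 0 ≤ b) (ht0 : 0 < t) (ht1 : t < 1)
    (hua : ∀ᵐ ω ∂F.filterLaw N,
      ∫⁻ y, ENNReal.ofReal (u (ω n, y) ^ 4) ∂F.generationKernel N n (ω n) ≤ ENNReal.ofReal a)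
    (hvb : ∫⁻ ω, ENNReal.ofReal (v (ω n) ^ 4) ∂F.filterLaw N ≤ ENNReal.ofReal b) :
    ∫⁻ ω, ENNReal.ofReal ((u (ω n, ω (n + 1)) + v (ω n)) ^ 4) ∂F.filterLaw N ≤
      ENNReal.ofReal (a / (1 - t) ^ 3 + b / t ^ 3) := by
  have ht : 0 < 1 - t := by linarith
  have hE : ∀ a : ℝ, 0 ≤ a ^ 4 := fun a => (show Even 4 by decide).pow_nonneg a
  have hum : Measurable fun z => ENNReal.ofReal (u z ^ 4) := (hu.pow_const 4).ennreal_ofReal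
  have hu' : ∫⁻ ω, ENNReal.ofReal (u (ω n, ω (n + 1)) ^ 4) ∂F.filterLaw N ≤ ENNReal.ofReal a := by
    rw [F.lintegral_filterLaw_succ N n hum]
    exact (lintegral_mono_ae hua).trans (by simp)
  calc ∫⁻ ω, ENNReal.ofReal ((u (ω n, ω (n + 1)) + v (ω n)) ^ 4) ∂F.filterLaw N
      ≤ ∫⁻ ω, (ENNReal.ofReal (1 / (1 - t) ^ 3) * ENNReal.ofReal (u (ω n, ω (n + 1)) ^ 4) +
          ENNReal.ofReal (1 / t ^ 3) * ENNReal.ofReal (v (ω n) ^ 4)) ∂F.filterLaw N := by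
        refine lintegral_mono fun ω => ?_
        rw [← ENNReal.ofReal_mul (by positivity), ← ENNReal.ofReal_mul (by positivity),
          ← ENNReal.ofReal_add (mul_nonneg (by positivity) (hE _))
            (mul_nonneg (by positivity) (hE _))]
        refine ENNReal.ofReal_le_ofReal ((add_pow_four_le ht0 ht1 _ _).trans_eq ?_)
        ring
    _ ≤ ENNReal.ofReal (1 / (1 - t) ^ 3) * ENNReal.ofReal a +
          ENNReal.ofReal (1 / t ^ 3) * ENNReal.ofReal b := by
        rw [lintegral_add_left, lintegral_const_mul' _ _ ENNReal.ofReal_ne_top,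
          lintegral_const_mul' _ _ ENNReal.ofReal_ne_top]
        · gcongr
        · exact (hum.comp ((measurable_pi_apply n).prodMk (measurable_pi_apply (n + 1)))).const_mul _
    _ = ENNReal.ofReal (a / (1 - t) ^ 3 + b / t ^ 3) := by
        rw [← ENNReal.ofReal_mul (by positivity), ← ENNReal.ofReal_mul (by positivity),
          ← ENNReal.ofReal_add (by positivity) (by positivity)]
        congr 1
        ring

lemma measurableSet_lintegral_generationKernel_le (N n : ℕ) {f : (ℕ → E (n + 1)) → ENNReal}
    (hf : Measurable f) (b : ENNReal) :
    MeasurableSet {x | ∫⁻ y, f y ∂F.generationKernel N n x ≤ b} :=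
  measurableSet_le hf.lintegral_kernel measurable_const

/-- The constant in the time-uniform fourth moment bound for the twisted means. -/
noncomputable def twistedConst (c δ : ℝ) : ℝ := selectionConst c δ / (δ ^ 2) ^ 4

lemma selectionConst_pos (hc : 0 < c) (hδ : 0 < δ) : 0 < selectionConst c δ := by
  have := localConst_pos hc
  unfold selectionConst; positivity

lemma twistedConst_pos (hc : 0 < c) (hδ : 0 < δ) : 0 < twistedConst c δ := by
  have := selectionConst_pos hc hδ
  unfold twistedConst; positivity

lemma lintegral_selectedMean_sub_twistedMean_le (hδ : 0 < δ) (hδ1 : δ < 1) (hc : 0 < c)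
    (hM : ∀ n, ∀ x y : E n, ∀ A : Set (E (n + 1)), MeasurableSet A →
      δ * (F.M n y).real A ≤ (F.M n x).real A)
    (hB : ∀ n x, c ≤ (F.M n x).real (F.B (n + 1))) {N : ℕ} (hN : 2 ≤ N) (n : ℕ)
    {h φ : E (n + 1) → ℝ} (hh : IsWeight δ h) (hφ : Measurable φ) {r : ℝ}
    (hr : ∀ x y, φ x - φ y ≤ r) :
    ∫⁻ ω, ENNReal.ofReal ((selectedMean N (F.B (n + 1)) h φ (ω (n + 1)) -
        F.twistedMean (n + 1) h φ) ^ 4) ∂F.filterLaw N ≤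
      ENNReal.ofReal (twistedConst c δ * r ^ 4 / ((N : ℝ) - 1) ^ 2) := by
  have hδ2 : δ ^ 2 < 1 := by nlinarith
  have hS := selectionConst_pos hc hδ
  have hT := twistedConst_pos hc hδ
  induction n generalizing r with
  | zero =>
    obtain ⟨s₀⟩ := F.nonempty_space 1
    have hsm := measurable_selectedMean N (F.measurableSet_B 1) hh.measurable hφ
    have hm : Measurable fun y => ENNReal.ofReal ((selectedMean N (F.B 1) h φ y -
        F.twistedMean 1 h φ) ^ 4) := ((hsm.sub_const _).pow_const 4).ennreal_ofReal
    have hR : F.twistedMean 1 h φ = (∫ y, (F.B 1).indicator 1 y * (h y * φ y) ∂F.M 0 F.x₀) /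
        ∫ y, (F.B 1).indicator 1 y * h y ∂F.M 0 F.x₀ := by
      rw [twistedMean, gamma_one F (measurable_G_mul_mul hh.measurable hφ)
        (hh.abs_G_mul_mul_le hδ hr s₀), gamma_one F (measurable_G_mul hh.measurable)
        (hh.abs_G_mul_le hδ s₀)]
      rfl
    have hloc := lintegral_selectedMean_sub_pow_four_le (F.M 0 F.x₀) (F.measurableSet_B 1) hc hδ
      (hB 0 F.x₀) hN hh hφ hr
    rw [← hR] at hloc
    -- Generation `0` is almost surely the constant sequence `x₀`, at which the generation kernel is
    -- by definition the i.i.d. law of `F.M 0 F.x₀`.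
    have hae := F.ae_filterLaw_zero N
      (measurableSet_lintegral_generationKernel_le N 0 hm _) hloc
    have := F.lintegral_filterLaw_succ N 0 (f := fun z => ENNReal.ofReal
      ((selectedMean N (F.B 1) h φ z.2 - F.twistedMean 1 h φ) ^ 4)) (hm.comp measurable_snd)
    refine this.trans_le ((lintegral_mono_ae hae).trans ?_)
    rw [lintegral_const, measure_univ, mul_one]
    refine ENNReal.ofReal_le_ofReal ?_
    have : selectionConst c δ ≤ twistedConst c δ :=
      le_div_self hS.le (by positivity) (pow_le_one₀ (by positivity) hδ2.le)
    gcongr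
  | succ n ih =>
    have hW := hh.pullWeight hδ hc (hM (n + 1)) (hB (n + 1))
    have hp := measurable_pullFun (F := F) hh.measurable hφ
    have hsm := measurable_selectedMean N (F.measurableSet_B (n + 1 + 1)) hh.measurable hφ
    have hsm' := measurable_selectedMean N (F.measurableSet_B (n + 1)) hW.measurable hp
    have hrec := ih hW hp (pullFun_sub_le hδ hδ1 hc (hM (n + 1)) (hB (n + 1)) hh hφ hr)
    let u : (ℕ → E (n + 1)) × (ℕ → E (n + 1 + 1)) → ℝ := fun z =>
      selectedMean N (F.B (n + 1 + 1)) h φ z.2 -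
        selectedMean N (F.B (n + 1)) (F.pullWeight (n + 1) h) (F.pullFun (n + 1) h φ) z.1
    let v : (ℕ → E (n + 1)) → ℝ := fun x =>
      selectedMean N (F.B (n + 1)) (F.pullWeight (n + 1) h) (F.pullFun (n + 1) h φ) x -
        F.twistedMean (n + 1) (F.pullWeight (n + 1) h) (F.pullFun (n + 1) h φ)
    have hu : Measurable u := (hsm.comp measurable_snd).sub (hsm'.comp measurable_fst)
    have hua : ∀ᵐ ω ∂F.filterLaw N, ∫⁻ y, ENNReal.ofReal (u (ω (n + 1), y) ^ 4)
        ∂F.generationKernel N (n + 1) (ω (n + 1)) ≤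
          ENNReal.ofReal (selectionConst c δ * r ^ 4 / ((N : ℝ) - 1) ^ 2) := by
      filter_upwards [ae_stops_filterLaw hc hB N n] with ω hω
      have hsel := hω.selection_eq hδ hc (hM (n + 1)) (hB (n + 1)) hN hh hφ hr
      simp only [u, ← hsel]
      exact lintegral_selectedMean_sub_pow_four_le (F.particleLaw N (n + 1) (ω (n + 1)))
        (F.measurableSet_B _) hc hδ (le_particleLaw_real hB N (n + 1) _) hN hh hφ hr
    -- With `t` equal to the contraction factor, the inherited term `A * (t * r) ^ 4 / t ^ 3` is `t
    -- * A * r ^ 4`. The fixed point of `A = selectionConst c δ / (1 - t) ^ 3 + t * A` is exactly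
    -- `twistedConst c δ`.
    have key := lintegral_add_pow_four_le (F := F) N (n + 1) hu (v := v) (t := 1 - δ ^ 2)
      (by positivity) (by positivity) (by linarith) (by nlinarith) hua hrec
    have huv : ∀ ω : Π n, (ℕ → E n), selectedMean N (F.B (n + 1 + 1)) h φ (ω (n + 1 + 1)) -
        F.twistedMean (n + 1 + 1) h φ = u (ω (n + 1), ω (n + 1 + 1)) + v (ω (n + 1)) := by
      intro ω
      rw [twistedMean_succ hδ hc (by omega) (hM (n + 1)) (hB (n + 1)) hh hφ hr]
      simp only [u, v]
      ring
    simp only [huv]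
    refine key.trans_eq ?_
    congr 1
    have : 1 - δ ^ 2 ≠ 0 := by linarith
    rw [twistedConst, sub_sub_cancel, mul_pow]
    field_simp
    ring

lemma isWeight_one {S : Type*} [MeasurableSpace S] (hδ1 : δ ≤ 1) : IsWeight δ (1 : S → ℝ) :=
  ⟨measurable_one, fun _ => one_pos, fun _ _ => by simpa using hδ1⟩

/-- The constant in the time-uniform fourth moment bound for the filter. -/
noncomputable def filterConst (c δ : ℝ) : ℝ := 8 * (localConst c + twistedConst c δ * 2 ^ 4)

lemma filterConst_pos (hc : 0 < c) (hδ : 0 < δ) : 0 < filterConst c δ := by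
  have := localConst_pos hc
  have := twistedConst_pos hc hδ
  unfold filterConst; positivity

/-- The last generation is not selected, so it contributes an unweighted local error. What remains
is the twisted error one step earlier, with weight `1` and a test function of oscillation at most `2
* K`. -/
lemma lintegral_etaHat_sub_eta_pow_four_le (hδ : 0 < δ) (hδ1 : δ < 1) (hc : 0 < c)
    (hM : ∀ n, ∀ x y : E n, ∀ A : Set (E (n + 1)), MeasurableSet A →
      δ * (F.M n y).real A ≤ (F.M n x).real A)
    (hB : ∀ n x, c ≤ (F.M n x).real (F.B (n + 1))) {N : ℕ} (hN : 2 ≤ N) (n : ℕ)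
    {φ : E (n + 1) → ℝ} (hφ : Measurable φ) {K : ℝ} (hK : ∀ y, |φ y| ≤ K) :
    ∫⁻ ω, ENNReal.ofReal ((F.etaHat N (n + 1) φ ω - F.eta (n + 1) φ) ^ 4) ∂F.filterLaw N ≤
      ENNReal.ofReal (filterConst c δ * K ^ 4 / ((N : ℝ) - 1) ^ 2) := by
  have hL := localConst_pos hc
  have hT := twistedConst_pos hc hδ
  obtain ⟨s₀⟩ := F.nonempty_space (n + 1)
  have hK0 : 0 ≤ K := (abs_nonneg _).trans (hK s₀)
  have hpm := measurable_particleMean N (F.measurableSet_B (n + 1)) hφ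
  cases n with
  | zero =>
    have hm : Measurable fun y => ENNReal.ofReal ((particleMean N (F.B 1) y φ -
        F.eta 1 φ) ^ 4) := ((hpm.sub_const _).pow_const 4).ennreal_ofReal
    have hloc := lintegral_particleMean_sub_pow_four_le (F.M 0 F.x₀) (F.measurableSet_B 1) hc
      (hB 0 F.x₀) hN hφ hK
    have heta : F.eta 1 φ = ∫ y, φ y ∂F.M 0 F.x₀ := F.eta_one hφ hK
    rw [← heta] at hloc
    have hae := F.ae_filterLaw_zero N
      (measurableSet_lintegral_generationKernel_le N 0 hm _) hloc
    have := F.lintegral_filterLaw_succ N 0 (f := fun z => ENNReal.ofReal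
      ((particleMean N (F.B 1) z.2 φ - F.eta 1 φ) ^ 4)) (hm.comp measurable_snd)
    refine this.trans_le ((lintegral_mono_ae hae).trans ?_)
    rw [lintegral_const, measure_univ, mul_one]
    refine ENNReal.ofReal_le_ofReal ?_
    have : localConst c ≤ filterConst c δ := by unfold filterConst; linarith
    gcongr
  | succ n =>
    have hMφ := F.measurable_mutate (n + 1) hφ
    have hMK := F.abs_mutate_le (n + 1) hK
    have hosc : ∀ x y, F.mutate (n + 1) φ x - F.mutate (n + 1) φ y ≤ 2 * K := fun x y => by
      have h1 := (abs_le.1 (hMK x)).2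
      have h2 := (abs_le.1 (hMK y)).1
      linarith
    have hrec := lintegral_selectedMean_sub_twistedMean_le hδ hδ1 hc hM hB hN n
      (isWeight_one hδ1.le) hMφ hosc
    have hsm := measurable_selectedMean N (F.measurableSet_B (n + 1)) measurable_one hMφ
    let u : (ℕ → E (n + 1)) × (ℕ → E (n + 1 + 1)) → ℝ := fun z =>
      particleMean N (F.B (n + 1 + 1)) z.2 φ -
        selectedMean N (F.B (n + 1)) 1 (F.mutate (n + 1) φ) z.1
    let v : (ℕ → E (n + 1)) → ℝ := fun x =>
      selectedMean N (F.B (n + 1)) 1 (F.mutate (n + 1) φ) x -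
        F.twistedMean (n + 1) 1 (F.mutate (n + 1) φ)
    have hu : Measurable u := (hpm.comp measurable_snd).sub (hsm.comp measurable_fst)
    have hua : ∀ᵐ ω ∂F.filterLaw N, ∫⁻ y, ENNReal.ofReal (u (ω (n + 1), y) ^ 4)
        ∂F.generationKernel N (n + 1) (ω (n + 1)) ≤
          ENNReal.ofReal (localConst c * K ^ 4 / ((N : ℝ) - 1) ^ 2) := by
      filter_upwards [ae_stops_filterLaw hc hB N n] with ω hω
      simp only [u, ← hω.integral_nextLaw_eq hN hφ hK]
      exact lintegral_particleMean_sub_pow_four_le (F.particleLaw N (n + 1) (ω (n + 1)))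
        (F.measurableSet_B _) hc (le_particleLaw_real hB N (n + 1) _) hN hφ hK
    have key := lintegral_add_pow_four_le (F := F) N (n + 1) hu (v := v) (t := 1 / 2)
      (by positivity) (by positivity) (by norm_num) (by norm_num) hua hrec
    have huv : ∀ ω : Π n, (ℕ → E n), F.etaHat N (n + 1 + 1) φ ω -
        F.eta (n + 1 + 1) φ = u (ω (n + 1), ω (n + 1 + 1)) + v (ω (n + 1)) := by
      intro ω
      rw [F.eta_succ (by omega) hφ hK]
      simp only [u, v, etaHat]
      ring
    simp only [huv]
    refine key.trans_eq ?_
    congr 1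
    rw [filterConst]
    ring

lemma abs_particleMean_le {S : Type*} (N : ℕ) (B : Set S) (x : ℕ → S) {f : S → ℝ} {K : ℝ}
    (hK0 : 0 ≤ K) (hK : ∀ y, |f y| ≤ K) : |particleMean N B x f| ≤ K := by
  rw [particleMean, abs_div]
  refine div_le_of_le_mul₀ (abs_nonneg _) hK0 ?_
  refine (Finset.abs_sum_le_sum_abs _ _).trans ((Finset.sum_le_sum fun i _ => hK (x i)).trans ?_)
  rw [Finset.sum_const, Finset.card_range, nsmul_eq_mul, mul_comm]
  refine mul_le_mul_of_nonneg_left ?_ hK0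
  -- At the default value `0` the truncated `0 - 1` makes the sum empty, while the denominator is
  -- `-1`.
  rcases Nat.eq_zero_or_pos (stopIndex N B x) with h | h
  · simp [h]
  · rw [Nat.cast_sub h, Nat.cast_one]
    exact le_abs_self _

end Propagation

end FKModel

/-! ### From the fourth moment to all exponents in `[1, 4]`. -/

lemma integral_abs_rpow_rpow_le_of_pow_four {Ω : Type*} [MeasurableSpace Ω] {μ : Measure Ω}
    [IsProbabilityMeasure μ] {X : Ω → ℝ} (hX : Measurable X) {b l p : ℝ} (hb : ∀ ω, |X ω| ≤ b)
    (hp1 : 1 ≤ p) (hp4 : p ≤ 4) (hl : 0 ≤ l)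
    (h4 : ∫⁻ ω, ENNReal.ofReal (X ω ^ 4) ∂μ ≤ ENNReal.ofReal (l ^ 4)) :
    Integrable (fun ω => |X ω| ^ p) μ ∧ (∫ ω, |X ω| ^ p ∂μ) ^ (1 / p) ≤ l := by
  have hp0 : 0 < p := by linarith
  have hL : ∀ q : ENNReal, MemLp X q μ := fun q =>
    MemLp.of_bound hX.aestronglyMeasurable b (ae_of_all _ hb)
  have hpt : (ENNReal.ofReal p).toReal = p := ENNReal.toReal_ofReal hp0.le
  have hne : ENNReal.ofReal p ≠ 0 := by simpa using hp0
  have hint := (hL (ENNReal.ofReal p)).integrable_norm_rpow hne ENNReal.ofReal_ne_top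
  have hnorm := (hL (ENNReal.ofReal p)).eLpNorm_eq_integral_rpow_norm hne ENNReal.ofReal_ne_top
  rw [hpt] at hint hnorm
  refine ⟨hint, ?_⟩
  have hle : eLpNorm X (ENNReal.ofReal p) μ ≤ eLpNorm X 4 μ :=
    eLpNorm_le_eLpNorm_of_exponent_le
      (ENNReal.ofReal_le_of_le_toReal (by simpa using hp4)) hX.aestronglyMeasurable
  have hnorm4 : eLpNorm X 4 μ ≤ ENNReal.ofReal l := by
    rw [eLpNorm_eq_lintegral_rpow_enorm_toReal (by norm_num) (by norm_num)]
    have hpow : ∀ ω, ‖X ω‖ₑ ^ (4 : ENNReal).toReal = ENNReal.ofReal (X ω ^ 4) := by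
      intro ω
      rw [← (show Even 4 by decide).pow_abs (X ω), ENNReal.ofReal_pow (abs_nonneg _),
        Real.enorm_eq_ofReal_abs]
      exact_mod_cast ENNReal.rpow_natCast _ 4
    simp only [hpow]
    refine (ENNReal.rpow_le_rpow h4 (by positivity)).trans_eq ?_
    rw [ENNReal.ofReal_rpow_of_nonneg (by positivity) (by positivity)]
    congr 1
    have := Real.pow_rpow_inv_natCast hl (n := 4) (by norm_num)
    simpa using this
  have hfin := hle.trans hnorm4
  rw [hnorm] at hfin
  rw [one_div]
  exact (ENNReal.ofReal_le_ofReal_iff hl).1 hfin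

theorem theorem1 {E : ℕ → Type*} [∀ n, MeasurableSpace (E n)] (F : FKModel E) (hF : F.Mixing)
    (p : ℝ) (hp : p ∈ Set.Icc (1 : ℝ) 4) :
    ∃ C : ℝ, ∀ n : ℕ, 1 ≤ n → ∀ N : ℕ, 2 ≤ N → ∀ φ : E n → ℝ, Measurable φ →
      (∃ K : ℝ, ∀ x, |φ x| ≤ K) →
      Integrable (fun ω => |F.etaHat N n φ ω - F.eta n φ| ^ p) (F.filterLaw N) ∧
      (∫ ω, |F.etaHat N n φ ω - F.eta n φ| ^ p ∂F.filterLaw N) ^ (1 / p) ≤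
        C * (⨆ x, |φ x|) / √((N : ℝ) - 1) := by
  obtain ⟨⟨δ, hδ, hδ1, hM⟩, c, hc, -, hcB⟩ := hF
  have hB : ∀ n x, c ≤ (F.M n x).real (F.B (n + 1)) := fun n x => (hcB n x).trans (min_le_left _ _)
  have hC := FKModel.filterConst_pos hc hδ
  -- The fourth root of the fourth moment constant serves for every `p`.
  refine ⟨FKModel.filterConst c δ ^ ((4 : ℕ) : ℝ)⁻¹, fun n hn N hN φ hφ ⟨K₀, hK₀⟩ => ?_⟩
  obtain ⟨n, rfl⟩ := Nat.exists_eq_add_of_le' hn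
  obtain ⟨s₀⟩ := F.nonempty_space (n + 1)
  set K := ⨆ x, |φ x|
  have hK : ∀ x, |φ x| ≤ K := le_ciSup (f := fun x => |φ x|) ⟨K₀, by rintro _ ⟨x, rfl⟩; exact hK₀ x⟩
  have hK0 : 0 ≤ K := (abs_nonneg _).trans (hK s₀)
  have hN' : (0 : ℝ) ≤ (N : ℝ) - 1 := by
    have : (2 : ℝ) ≤ N := by exact_mod_cast hN
    linarith
  have hmeas : Measurable fun ω => F.etaHat N (n + 1) φ ω - F.eta (n + 1) φ :=
    ((FKModel.measurable_particleMean N (F.measurableSet_B (n + 1)) hφ).comp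
      (measurable_pi_apply (n + 1))).sub_const _
  refine integral_abs_rpow_rpow_le_of_pow_four hmeas (b := K + |F.eta (n + 1) φ|)
    (fun ω => (abs_sub _ _).trans
      (add_le_add_left (FKModel.abs_particleMean_le N _ _ hK0 hK) _)) hp.1 hp.2 (by positivity) ?_
  refine (FKModel.lintegral_etaHat_sub_eta_pow_four_le hδ hδ1 hc hM hB hN n hφ hK).trans_eq ?_
  congr 1
  rw [div_pow, mul_pow, Real.rpow_inv_natCast_pow hC.le (by norm_num),
    show √((N : ℝ) - 1) ^ 4 = (√((N : ℝ) - 1) ^ 2) ^ 2 by ring, Real.sq_sqrt hN']
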